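/- Let $n\ge 1$, $G=\mathrm{SO}(2,2n)$, $H=\mathrm{SO}(1,2n)$, embedded in $G$ as the block-diagonal matrices $\mathrm{diag}(1,h)$, and let $L=\mathrm{U}(1,n)$, embedded in $G$ through $\mathbb{C}^{1+n}=\mathbb{R}^{2+2n}$. Let $X=G/H$ be the homogeneous space with its quotient topology and its standard smooth structure (for which a function on an open subset of $X$ is smooth if and only if its pullback to $G$ is smooth), and let $L$ act on $X$ by left multiplication. For a Hausdorff space $Y$ let $\mathcal{B}_{\mathrm{cpt}}(Y)$ be the family of all relatively compact subsets of $Y$. For $B\subset X$ put $$E(L,B)=\{(lb_1,lb_2)\mid l\in L,\ b_1,b_2\in B\}\cup\{(x,x)\mid x\in X\},$$ and let $$\mathcal{E}(L,\mathcal{B}_{\mathrm{cpt}}(X))=\{E\subset X\times X\mid E\subset E(L,B)\text{ for some }B\in\mathcal{B}_{\mathrm{cpt}}(X)\}.$$ Then the action is bornologically proper, that is, $\{l\in L\mid lB\cap B'\ne\emptyset\}\in\mathcal{B}_{\mathrm{cpt}}(L)$ for all $B,B'\in\mathcal{B}_{\mathrm{cpt}}(X)$. The standard smooth structure on $X$ exists,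 with $\dim X=2n+1$. Moreover, there is a smooth Riemannian metric on $X$ whose associated distance function $d$ (the infimum of the lengths of $C^1$ paths) is a metric inducing the topology of $X$ and has the following two properties. 1. A subset of $X$ is $d$-bounded if and only if it is relatively compact: $\mathcal{B}_d=\mathcal{B}_{\mathrm{cpt}}(X)$. 2. $\mathcal{E}(L,\mathcal{B}_{\mathrm{cpt}}(X))=\mathcal{E}_d$, where $\mathcal{E}_d$ is the bounded coarse structure, i.e. the family of all $E\subset X\times X$ such that, for some $r\ge 0$, $d(x,y)\le r$ for all $(x,y)\in E$. -/

import Mathlib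

open Matrix Set Manifold
open scoped ContDiff

/-! ### Bornologies, coarse structures and group actions -/

/-- The compact bornology: all relatively compact subsets. -/
def compactBornology (X : Type*) [TopologicalSpace X] : Set (Set X) :=
  {B | IsCompact (closure B)}

/-- The metric bornology of a distance function `d`: all metrically bounded subsets. -/
def metricBornology {X : Type*} (d : X → X → ℝ) : Set (Set X) :=
  {B | ∃ C : ℝ, ∀ x ∈ B, ∀ y ∈ B, d x y ≤ C}

/-- The bounded coarse structure of a distance function `d`: all subsets of
`E_r = {(x, y) | d x y ≤ r}` for some `r ≥ 0`. -/
def boundedCoarseStructure {X : Type*} (d : X → X → ℝ) : Set (Set (X × X)) :=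
  {E | ∃ r : ℝ, 0 ≤ r ∧ E ⊆ {p | d p.1 p.2 ≤ r}}

/-- `E(L, B) = {(l b₁, l b₂) | l ∈ L, b₁ b₂ ∈ B} ∪ diag X`. -/
def actionEntourage (L : Type*) {X : Type*} [SMul L X] (B : Set X) : Set (X × X) :=
  {p | ∃ l : L, ∃ b₁ ∈ B, ∃ b₂ ∈ B, p = (l • b₁, l • b₂)} ∪ Set.diagonal X

/-- The coarse structure associated with an action of `L` and a bornology `𝓑` on `X`: all subsets
of some `E(L, B)` with `B ∈ 𝓑`. -/
def associatedCoarseStructure (L : Type*) {X : Type*} [SMul L X] (𝓑 : Set (Set X)) :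
    Set (Set (X × X)) :=
  {E | ∃ B ∈ 𝓑, E ⊆ actionEntourage L B}

/-- Bornological properness: `{l | l B ∩ B' ≠ ∅}` is bounded in `L` for all bounded `B, B'`. -/
def IsBornologicallyProper {L X : Type*} [SMul L X] (𝓑L : Set (Set L)) (𝓑X : Set (Set X)) :
    Prop :=
  ∀ B ∈ 𝓑X, ∀ B' ∈ 𝓑X, {l : L | (((fun x => l • x) '' B) ∩ B').Nonempty} ∈ 𝓑L

/-! ### The groups `SO(p, q)` and `U(p, q)`

The form of signature `(p, q)` is the diagonal one on the index type `p ⊕ q`, with `1` on `p` and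
`-1` on `q`; here `p` and `q` are finite types, standing for their numbers of elements. -/

open LieAlgebra.Orthogonal (indefiniteDiagonal)

/-- `SO(p, q)`: the real matrices of determinant one preserving the form of signature `(p, q)`. -/
def indefiniteSO (p q : Type*) [Fintype p] [Fintype q] [DecidableEq p] [DecidableEq q] :
    Subgroup (SpecialLinearGroup (p ⊕ q) ℝ) where
  carrier := {g | g.1ᵀ * indefiniteDiagonal p q ℝ * g.1 = indefiniteDiagonal p q ℝ}
  one_mem' := by simp
  mul_mem' := by
    intro a b ha hb
    change (a.1 * b.1)ᵀ * indefiniteDiagonal p q ℝ * (a.1 * b.1) = _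
    change a.1ᵀ * _ * a.1 = _ at ha
    change b.1ᵀ * _ * b.1 = _ at hb
    calc _ = b.1ᵀ * (a.1ᵀ * indefiniteDiagonal p q ℝ * a.1) * b.1 := by
          simp only [transpose_mul, Matrix.mul_assoc]
      _ = _ := by rw [ha, hb]
  inv_mem' := by
    intro a ha
    change a.1ᵀ * _ * a.1 = _ at ha
    change a⁻¹.1ᵀ * indefiniteDiagonal p q ℝ * a⁻¹.1 = _
    have h1 : a.1 * a⁻¹.1 = 1 := congrArg Subtype.val (mul_inv_cancel a)
    have h2 := congrArg Matrix.transpose h1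
    rw [transpose_mul, transpose_one] at h2
    nth_rewrite 1 [← ha]
    simp only [Matrix.mul_assoc, h1, Matrix.mul_one]
    rw [← Matrix.mul_assoc, h2, Matrix.one_mul]

/-- `U(p, q)`: the complex matrices preserving the Hermitian form of signature `(p, q)`. -/
def indefiniteU (p q : Type*) [Fintype p] [Fintype q] [DecidableEq p] [DecidableEq q] :
    Subgroup (GL (p ⊕ q) ℂ) where
  carrier := {g | g.1ᴴ * indefiniteDiagonal p q ℂ * g.1 = indefiniteDiagonal p q ℂ}
  one_mem' := by simp
  mul_mem' := by
    intro a b ha hb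
    simp only [Set.mem_ofPred_eq, Units.val_mul, conjTranspose_mul] at *
    calc _ = (b : Matrix (p ⊕ q) (p ⊕ q) ℂ)ᴴ * ((a : Matrix (p ⊕ q) (p ⊕ q) ℂ)ᴴ
          * indefiniteDiagonal p q ℂ * a) * b := by simp only [Matrix.mul_assoc]
      _ = _ := by rw [ha, hb]
  inv_mem' := by
    intro a ha
    simp only [Set.mem_ofPred_eq] at *
    have h1 : (a : Matrix (p ⊕ q) (p ⊕ q) ℂ) * (a⁻¹ : GL (p ⊕ q) ℂ) = 1 := by
      rw [← Units.val_mul, mul_inv_cancel, Units.val_one]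
    have h2 := congrArg Matrix.conjTranspose h1
    rw [conjTranspose_mul, conjTranspose_one] at h2
    nth_rewrite 1 [← ha]
    simp only [Matrix.mul_assoc, h1, Matrix.mul_one]
    rw [← Matrix.mul_assoc, h2, Matrix.one_mul]

/-! ### The inclusion `SO(p, q) ⊆ SO(1 + p, q)` -/

section BlockInclusion

variable {p q : Type*} [Fintype p] [Fintype q] [DecidableEq p] [DecidableEq q]

/-- The block diagonal matrix `diag(1, h)`, on the index type `(1 + p) + q`. -/
def blockOne (h : Matrix (p ⊕ q) (p ⊕ q) ℝ) :
    Matrix ((Fin 1 ⊕ p) ⊕ q) ((Fin 1 ⊕ p) ⊕ q) ℝ :=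
  (fromBlocks (1 : Matrix (Fin 1) (Fin 1) ℝ) 0 0 h).submatrix
    (Equiv.sumAssoc (Fin 1) p q) (Equiv.sumAssoc (Fin 1) p q)

theorem blockOne_mul (g h : Matrix (p ⊕ q) (p ⊕ q) ℝ) :
    blockOne (g * h) = blockOne g * blockOne h := by
  unfold blockOne
  rw [submatrix_mul_equiv, fromBlocks_multiply]
  simp

theorem blockOne_one : blockOne (1 : Matrix (p ⊕ q) (p ⊕ q) ℝ) = 1 := by
  unfold blockOne
  rw [fromBlocks_one, submatrix_one_equiv]

theorem blockOne_det (h : Matrix (p ⊕ q) (p ⊕ q) ℝ) : (blockOne h).det = h.det := by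
  unfold blockOne
  rw [det_submatrix_equiv_self, det_fromBlocks_zero₂₁, det_one, one_mul]

theorem blockOne_transpose (h : Matrix (p ⊕ q) (p ⊕ q) ℝ) : (blockOne h)ᵀ = blockOne hᵀ := by
  unfold blockOne
  rw [transpose_submatrix, fromBlocks_transpose]
  simp

theorem blockOne_indefiniteDiagonal :
    blockOne (indefiniteDiagonal p q ℝ) = indefiniteDiagonal (Fin 1 ⊕ p) q ℝ := by
  ext i j
  rcases i with (i | i) | i <;> rcases j with (j | j) | j <;>
    simp [blockOne, indefiniteDiagonal, diagonal_apply, Matrix.one_apply]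

/-- The embedding `h ↦ diag(1, h)` of `SO(p, q)` in `SO(1 + p, q)`. -/
def indefiniteSOEmbedding (p q : Type*) [Fintype p] [Fintype q] [DecidableEq p] [DecidableEq q] :
    indefiniteSO p q →* indefiniteSO (Fin 1 ⊕ p) q where
  toFun h := ⟨⟨blockOne h.1.1, by rw [blockOne_det]; exact h.1.2⟩, by
    have h2 := congrArg blockOne (show _ = _ from h.2)
    rw [blockOne_mul, blockOne_mul, ← blockOne_transpose, blockOne_indefiniteDiagonal] at h2
    exact h2⟩
  map_one' := Subtype.ext (Subtype.ext blockOne_one)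
  map_mul' g h := Subtype.ext (Subtype.ext (blockOne_mul g.1.1 h.1.1))

end BlockInclusion

/-! ### The inclusion `U(p, q) ⊆ SO(2p, 2q)` -/

section Realification

variable {p q : Type*} [Fintype p] [Fintype q] [DecidableEq p] [DecidableEq q]

/-- The real matrix of the `ℝ`-linear map `ℂ^(p+q) → ℂ^(p+q)` given by a complex matrix `A`, namely
the block matrix `(Re A, -Im A; Im A, Re A)`, with coordinates listed in the order
`Re z_p, Im z_p, Re z_q, Im z_q`. -/
def realify (A : Matrix (p ⊕ q) (p ⊕ q) ℂ) :
    Matrix ((p ⊕ p) ⊕ (q ⊕ q)) ((p ⊕ p) ⊕ (q ⊕ q)) ℝ :=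
  (fromBlocks (A.map Complex.re) (-A.map Complex.im) (A.map Complex.im)
    (A.map Complex.re)).submatrix
    (Equiv.sumSumSumComm p q p q).symm (Equiv.sumSumSumComm p q p q).symm

theorem realify_mul (A B : Matrix (p ⊕ q) (p ⊕ q) ℂ) :
    realify (A * B) = realify A * realify B := by
  have hre : (A * B).map Complex.re
      = A.map Complex.re * B.map Complex.re - A.map Complex.im * B.map Complex.im := by
    ext i j
    simp only [map_apply, Matrix.sub_apply, Matrix.mul_apply, Complex.re_sum, Complex.mul_re,
      Finset.sum_sub_distrib]
  have him : (A * B).map Complex.im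
      = A.map Complex.re * B.map Complex.im + A.map Complex.im * B.map Complex.re := by
    ext i j
    simp only [map_apply, Matrix.add_apply, Matrix.mul_apply, Complex.im_sum, Complex.mul_im,
      Finset.sum_add_distrib]
  unfold realify
  rw [submatrix_mul_equiv, fromBlocks_multiply, hre, him]
  congr 2
  · simp [sub_eq_add_neg]
  · simp only [Matrix.mul_neg, Matrix.neg_mul]; abel
  · abel
  · simp only [Matrix.mul_neg]; abel

theorem realify_one : realify (1 : Matrix (p ⊕ q) (p ⊕ q) ℂ) = 1 := by
  have hre : (1 : Matrix (p ⊕ q) (p ⊕ q) ℂ).map Complex.re = 1 :=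
    Matrix.map_one _ Complex.zero_re Complex.one_re
  have him : (1 : Matrix (p ⊕ q) (p ⊕ q) ℂ).map Complex.im = 0 := by
    ext i j
    by_cases h : i = j <;> simp [h]
  unfold realify
  rw [hre, him, neg_zero, fromBlocks_one, submatrix_one_equiv]

theorem realify_transpose (A : Matrix (p ⊕ q) (p ⊕ q) ℂ) : (realify A)ᵀ = realify Aᴴ := by
  unfold realify
  rw [transpose_submatrix, fromBlocks_transpose]
  congr 2 <;> ext i j <;> simp

theorem realify_indefiniteDiagonal :
    realify (indefiniteDiagonal p q ℂ) = indefiniteDiagonal (p ⊕ p) (q ⊕ q) ℝ := by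
  ext i j
  rcases i with (i | i) | (i | i) <;> rcases j with (j | j) | (j | j) <;>
    simp [realify, indefiniteDiagonal, diagonal_apply, apply_ite Complex.re, apply_ite Complex.im]

theorem realify_det (A : Matrix (p ⊕ q) (p ⊕ q) ℂ) :
    ((realify A).det : ℂ) = A.det * star A.det := by
  set a : Matrix (p ⊕ q) (p ⊕ q) ℂ := (A.map Complex.re).map Complex.ofRealHom with ha
  set b : Matrix (p ⊕ q) (p ⊕ q) ℂ := (A.map Complex.im).map Complex.ofRealHom with hb
  have hA : a + Complex.I • b = A := by
    ext i j
    simp [ha, hb, mul_comm Complex.I, Complex.re_add_im]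
  have hA' : a - Complex.I • b = A.map star := by
    ext i j
    apply Complex.ext <;> simp [ha, hb]
  have hmul : fromBlocks 1 (Complex.I • 1) 0 1 * fromBlocks a (-b) b a
      * fromBlocks 1 (-(Complex.I • 1)) 0 1 = fromBlocks A 0 b (A.map star) := by
    rw [← hA', ← hA, fromBlocks_multiply, fromBlocks_multiply]
    have hI : Complex.I • Complex.I • b = -b := by rw [smul_smul, Complex.I_mul_I, neg_one_smul]
    congr 1 <;> simp [hI]
    all_goals abel
  have hdet := congrArg Matrix.det hmul
  rw [det_mul, det_mul, det_fromBlocks_zero₂₁, det_fromBlocks_zero₂₁, det_fromBlocks_zero₁₂] at hdet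
  simp only [det_one, mul_one, one_mul] at hdet
  have hs : (A.map star).det = star A.det := by
    rw [← det_conjTranspose, conjTranspose, ← det_transpose, transpose_map]
  rw [hs] at hdet
  rw [← hdet]
  unfold realify
  rw [det_submatrix_equiv_self]
  change Complex.ofRealHom _ = _
  rw [RingHom.map_det, RingHom.mapMatrix_apply, fromBlocks_map]
  congr 2
  ext i j
  simp [hb]

theorem realify_det_eq_one {A : Matrix (p ⊕ q) (p ⊕ q) ℂ}
    (hA : Aᴴ * indefiniteDiagonal p q ℂ * A = indefiniteDiagonal p q ℂ) :
    (realify A).det = 1 := by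
  have h := congrArg Matrix.det hA
  rw [det_mul, det_mul, det_conjTranspose] at h
  have hJ : (indefiniteDiagonal p q ℂ).det ≠ 0 := by
    rw [indefiniteDiagonal, det_diagonal, Finset.prod_ne_zero_iff]
    rintro (i | i) _ <;> simp
  have h2 : A.det * star A.det = 1 := by
    apply mul_right_cancel₀ hJ
    linear_combination h
  rw [← realify_det] at h2
  exact_mod_cast h2

/-- The embedding of `U(p, q)` in `SO(2p, 2q)` given by `ℂ^(p+q) = ℝ^(2p+2q)`. -/
def indefiniteUEmbedding (p q : Type*) [Fintype p] [Fintype q] [DecidableEq p] [DecidableEq q] :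
    indefiniteU p q →* indefiniteSO (p ⊕ p) (q ⊕ q) where
  toFun g := ⟨⟨realify g.1.1, realify_det_eq_one g.2⟩, by
    have h2 := congrArg realify (show _ = _ from g.2)
    rw [realify_mul, realify_mul, ← realify_transpose, realify_indefiniteDiagonal] at h2
    exact h2⟩
  map_one' := Subtype.ext (Subtype.ext realify_one)
  map_mul' g h := Subtype.ext (Subtype.ext (realify_mul g.1.1 h.1.1))

end Realification

/-! ### The homogeneous space `SO(2, 2n) / SO(1, 2n)` -/

/-- `SO(2, 2n)`, with `2 = 1 + 1` and `2n = n + n`. -/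
abbrev GroupSO (n : ℕ) : Type := indefiniteSO (Fin 1 ⊕ Fin 1) (Fin n ⊕ Fin n)

/-- `SO(1, 2n)` as the subgroup of all `diag(1, h)` in `SO(2, 2n)`. -/
def subgroupSO (n : ℕ) : Subgroup (GroupSO n) :=
  (indefiniteSOEmbedding (Fin 1) (Fin n ⊕ Fin n)).range

/-- `U(1, n)`. -/
abbrev GroupU (n : ℕ) : Type := indefiniteU (Fin 1) (Fin n)

/-- `X = SO(2, 2n) / SO(1, 2n)`, with the quotient topology. -/
abbrev HomogSpace (n : ℕ) : Type := GroupSO n ⧸ subgroupSO n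

/-- The natural action of `U(1, n) ⊆ SO(2, 2n)` on `X`. -/
instance homogSpaceAction (n : ℕ) : MulAction (GroupU n) (HomogSpace n) :=
  MulAction.compHom (HomogSpace n) (indefiniteUEmbedding (Fin 1) (Fin n))

/-- Smoothness, on a subset `W` of `SO(2, 2n)`, of a real-valued function: near each point of `W` it
is the restriction of a smooth function of the matrix entries. For open `W` this is smoothness on
an open subset of the Lie group `SO(2, 2n)`. -/
def SmoothOnGroup {n : ℕ} (f : GroupSO n → ℝ) (W : Set (GroupSO n)) : Prop :=
  ∀ g ∈ W, ∃ V : Set (((Fin 1 ⊕ Fin 1) ⊕ (Fin n ⊕ Fin n)) → ((Fin 1 ⊕ Fin 1) ⊕ (Fin n ⊕ Fin n)) → ℝ),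
    IsOpen V ∧ (fun i j => g.1.1 i j) ∈ V ∧
    ∃ F : (((Fin 1 ⊕ Fin 1) ⊕ (Fin n ⊕ Fin n)) → ((Fin 1 ⊕ Fin 1) ⊕ (Fin n ⊕ Fin n)) → ℝ) → ℝ,
      ContDiffOn ℝ ∞ F V ∧
      ∀ h ∈ W, (fun i j => h.1.1 i j) ∈ V → f h = F (fun i j => h.1.1 i j)

/-- A charted space structure on `X` is the smooth manifold structure of the homogeneous space if
it is smooth and if a function on an open subset of `X` is smooth exactly when its pullback to the
group is (this determines the smooth structure, the one for which the projection from the group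
is a smooth submersion). -/
structure IsHomogeneousSmoothStructure (n : ℕ)
    [ChartedSpace (EuclideanSpace ℝ (Fin (2 * n + 1))) (HomogSpace n)] : Prop where
  isManifold : IsManifold (𝓡 (2 * n + 1)) ∞ (HomogSpace n)
  smooth_iff : ∀ (U : Set (HomogSpace n)), IsOpen U → ∀ f : HomogSpace n → ℝ,
    ContMDiffOn (𝓡 (2 * n + 1)) 𝓘(ℝ, ℝ) ∞ f U ↔
      SmoothOnGroup (fun g => f (QuotientGroup.mk g)) (QuotientGroup.mk ⁻¹' U)

/-- `d` is a metric on the set `X`, and it induces the given topology of `X`. -/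
def IsCompatibleMetric {X : Type*} [t : TopologicalSpace X] (d : X → X → ℝ) : Prop :=
  ∃ m : MetricSpace X, m.toUniformSpace.toTopologicalSpace = t ∧ m.dist = d

open scoped Bundle in
/-- `d` is the distance function of the Riemannian metric tensor `g`: the infimum of the lengths of
the `C^1` paths between two points (in particular, this infimum is finite). -/
def IsRiemannianDistance {E H M : Type*} [NormedAddCommGroup E] [NormedSpace ℝ E]
    [TopologicalSpace H] {I : ModelWithCorners ℝ E H} [TopologicalSpace M] [ChartedSpace H M]
    [IsManifold I ∞ M]
    (g : Bundle.ContMDiffRiemannianMetric I ∞ E (fun x : M => TangentSpace I x))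
    (d : M → M → ℝ) : Prop :=
  letI : Bundle.RiemannianBundle (fun x : M => TangentSpace I x) := ⟨g.toRiemannianMetric⟩
  ∀ x y : M, riemannianEDist I x y = ENNReal.ofReal (d x y)

set_option linter.unusedSectionVars false
set_option linter.unusedVariables false

open Topology Filter

/-! Let `e` be the first basis vector. The map `gH ↦ g e` identifies `X` with the quadric `Q` of
vectors of square one in `ℝ^(2+2n) = ℂ^(1+n)`. Products of two reflections give smooth local
sections of it, so it is a topological embedding (`isEmbedding_orbitMap`), and forgetting the first
coordinate gives charts, moved around by the group. In any smooth structure as in the theorem it is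
an immersion, because each chart is locally the restriction of a smooth map on the ambient space
(`exists_chart_extension`).

The metric comes from the Hermitian form `h` of signature `(1, n)`. For `v` in `Q`, `h` is negative
definite on the complement of `v` and positive on the line `ℂ v`; adding `2 |h(v, w)|²` to `-h(w,
w)` corrects the sign on that line and gives a positive definite form on the whole ambient space
(`invariantForm_pos`). It is built from `h` and `v` alone, hence invariant under `L = U(1, n)`, and
its pullback is an `L`-invariant Riemannian metric on `X`.

If `l` maps a point of a compact set `K` into a compact set `K'`, comparing these forms with the
norm over `K` and `K'` bounds the entries of `l`; this is bornological properness.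

`L` is transitive on `Q` (`exists_unitary_mulVec`) and `X` is connected, so the Riemannian distance
is finite, and `X` is a locally compact length space with transitive isometries. Such a space is
proper (`properSpace_of_transitive_of_intermediate`): bounded sets are the relatively compact ones.
For the coarse structures, invariance bounds the distance on `E(L, B)` by the diameter of `B`;
conversely a pair at distance at most `r` is moved by `L` to one with first entry a fixed `a`, so it
lies in `E(L, B)` for `B` the closed ball of radius `r` at `a`. -/

/-! ### Reflections and a local section of the orbit map -/

section Reflection

variable {ι : Type*} [Fintype ι] [DecidableEq ι]

/-- The reflection in the vector `u` with respect to the symmetric bilinear form with matrix `J`. -/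
noncomputable def formReflection (J : Matrix ι ι ℝ) (u : ι → ℝ) : Matrix ι ι ℝ :=
  1 - (2 / (u ⬝ᵥ J *ᵥ u)) • vecMulVec u (J *ᵥ u)

theorem formReflection_mulVec (J : Matrix ι ι ℝ) (u v : ι → ℝ) :
    formReflection J u *ᵥ v = v - (2 / (u ⬝ᵥ J *ᵥ u) * ((J *ᵥ u) ⬝ᵥ v)) • u := by
  rw [formReflection, sub_mulVec, one_mulVec, smul_mulVec, vecMulVec_mulVec, mul_smul]
  ext i
  simp [mul_comm]

/-- The matrix determinant lemma for a rank one perturbation of the identity: `1 - 2 = -1`. -/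
theorem det_formReflection (J : Matrix ι ι ℝ) {u : ι → ℝ} (hu : u ⬝ᵥ J *ᵥ u ≠ 0) :
    (formReflection J u).det = -1 := by
  have h : formReflection J u = 1 + vecMulVec (-(2 / (u ⬝ᵥ J *ᵥ u)) • u) (J *ᵥ u) := by
    rw [formReflection, smul_vecMulVec, neg_smul, sub_eq_add_neg]
  rw [h, vecMulVec_eq Unit, det_one_add_replicateCol_mul_replicateRow, dotProduct_smul,
    dotProduct_comm (J *ᵥ u) u]
  simp only [smul_eq_mul]
  field_simp
  norm_num

theorem transpose_formReflection_mul (J : Matrix ι ι ℝ) (hJ : Jᵀ = J) {u : ι → ℝ}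
    (hu : u ⬝ᵥ J *ᵥ u ≠ 0) : (formReflection J u)ᵀ * J * formReflection J u = J := by
  have h1 : vecMulVec (J *ᵥ u) u * J = vecMulVec (J *ᵥ u) (J *ᵥ u) := by
    rw [vecMulVec_mul, ← mulVec_transpose, hJ]
  have h2 : J * vecMulVec u (J *ᵥ u) = vecMulVec (J *ᵥ u) (J *ᵥ u) := by
    rw [mul_vecMulVec]
  have h3 : vecMulVec (J *ᵥ u) (J *ᵥ u) * vecMulVec u (J *ᵥ u)
      = (u ⬝ᵥ J *ᵥ u) • vecMulVec (J *ᵥ u) (J *ᵥ u) := by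
    rw [vecMulVec_mul_vecMulVec, vecMulVec_smul, dotProduct_comm]
  unfold formReflection
  rw [transpose_sub, transpose_one, transpose_smul, transpose_vecMulVec, sub_mul, one_mul,
    smul_mul_assoc, h1, mul_sub, mul_one, mul_smul_comm, sub_mul, h2, smul_mul_assoc, h3]
  set c := u ⬝ᵥ J *ᵥ u
  have h4 : (2 / c) • (2 / c) • c • vecMulVec (J *ᵥ u) (J *ᵥ u)
      = (2 / c) • vecMulVec (J *ᵥ u) (J *ᵥ u) + (2 / c) • vecMulVec (J *ᵥ u) (J *ᵥ u) := by
    rw [smul_smul, smul_smul, ← add_smul]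
    congr 1
    field_simp
    ring
  rw [smul_sub, h4]
  abel

/-- For `w` with the same value of the quadratic form as `e`, a product of two reflections mapping
`e` to `w`. -/
noncomputable def twoReflections (J : Matrix ι ι ℝ) (e w : ι → ℝ) : Matrix ι ι ℝ :=
  formReflection J (e + w) * formReflection J e

variable {J : Matrix ι ι ℝ} {e : ι → ℝ}

/-- The first reflection sends `e` to `-e`. As `e` and `w` have equal squares, `e - w` is orthogonal
to `e + w`, so the second one sends `-e` to `w`. Two reflections are used to get determinant one. -/
theorem twoReflections_mulVec (hJ : Jᵀ = J) {w : ι → ℝ} (he : e ⬝ᵥ J *ᵥ e = 1)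
    (hw : w ⬝ᵥ J *ᵥ w = 1) (h : (e + w) ⬝ᵥ J *ᵥ (e + w) ≠ 0) :
    twoReflections J e w *ᵥ e = w := by
  have hs : w ⬝ᵥ J *ᵥ e = e ⬝ᵥ J *ᵥ w := by
    rw [dotProduct_mulVec, ← mulVec_transpose, hJ, dotProduct_comm]
  have h1 : (e + w) ⬝ᵥ J *ᵥ (e + w) = 2 * (1 + e ⬝ᵥ J *ᵥ w) := by
    rw [mulVec_add, dotProduct_add, add_dotProduct, add_dotProduct, he, hw, hs]
    ring
  have h2 : formReflection J e *ᵥ e = -e := by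
    rw [formReflection_mulVec, dotProduct_comm (J *ᵥ e), he]
    ext i
    simp
    ring
  rw [twoReflections, ← mulVec_mulVec, h2, mulVec_neg, formReflection_mulVec, h1,
    dotProduct_comm (J *ᵥ (e + w)), mulVec_add, dotProduct_add, he]
  rw [h1] at h
  have h3 : 2 / (2 * (1 + e ⬝ᵥ J *ᵥ w)) * (1 + e ⬝ᵥ J *ᵥ w) = 1 := by
    field_simp
    exact div_self (fun h0 => h (by rw [h0, mul_zero]))
  rw [h3]
  simp

theorem det_twoReflections {w : ι → ℝ} (he : e ⬝ᵥ J *ᵥ e ≠ 0)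
    (h : (e + w) ⬝ᵥ J *ᵥ (e + w) ≠ 0) : (twoReflections J e w).det = 1 := by
  rw [twoReflections, det_mul, det_formReflection J h, det_formReflection J he]
  norm_num

theorem transpose_twoReflections_mul (hJ : Jᵀ = J) {w : ι → ℝ} (he : e ⬝ᵥ J *ᵥ e ≠ 0)
    (h : (e + w) ⬝ᵥ J *ᵥ (e + w) ≠ 0) :
    (twoReflections J e w)ᵀ * J * twoReflections J e w = J := by
  have h1 := transpose_formReflection_mul J hJ h
  have h2 := transpose_formReflection_mul J hJ he
  rw [twoReflections, transpose_mul]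
  calc _ = (formReflection J e)ᵀ * ((formReflection J (e + w))ᵀ * J * formReflection J (e + w))
        * formReflection J e := by simp only [Matrix.mul_assoc]
    _ = J := by rw [h1, h2]

/-- A reflection depends only on the line spanned by its vector and is an involution. This makes the
local section at `g` pass through `g` itself. -/
theorem twoReflections_self (he : e ⬝ᵥ J *ᵥ e = 1) : twoReflections J e e = 1 := by
  have h0 : formReflection J (e + e) = formReflection J e := by
    have h2 : e + e = (2 : ℝ) • e := (two_smul ℝ e).symm
    unfold formReflection
    rw [h2, mulVec_smul, smul_dotProduct, dotProduct_smul, he, vecMulVec_smul, smul_vecMulVec,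
      smul_smul, smul_smul]
    norm_num
  rw [twoReflections, h0]
  unfold formReflection
  rw [he, mul_sub, sub_mul, sub_mul, smul_mul_smul, vecMulVec_mul_vecMulVec,
    dotProduct_comm (J *ᵥ e) e, he]
  simp only [one_mul, mul_one, one_smul]
  ext i j
  simp
  ring

theorem continuous_form (J : Matrix ι ι ℝ) : Continuous fun w : ι → ℝ => w ⬝ᵥ J *ᵥ w := by
  fun_prop

theorem contDiff_mulVec {κ : Type*} [Fintype κ] (A : Matrix κ ι ℝ) {k : WithTop ℕ∞} :
    ContDiff ℝ k fun w : ι → ℝ => A *ᵥ w :=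
  (LinearMap.toContinuousLinearMap A.mulVecLin).contDiff

theorem contDiff_dotProduct_mulVec (J : Matrix ι ι ℝ) {k : WithTop ℕ∞} :
    ContDiff ℝ k fun w : ι → ℝ => w ⬝ᵥ J *ᵥ w := by
  unfold dotProduct
  refine ContDiff.sum fun i _ => (contDiff_apply ℝ ℝ i).mul ?_
  exact (contDiff_apply ℝ ℝ i).comp (contDiff_mulVec J)

/-- The entries are rational in `w`, and the only denominator is the square of `e + w`. -/
theorem contDiffAt_twoReflections {w : ι → ℝ} (h : (e + w) ⬝ᵥ J *ᵥ (e + w) ≠ 0) (A B : Matrix ι ι ℝ)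
    {k : WithTop ℕ∞} :
    ContDiffAt ℝ k (fun w i j => (A * twoReflections J e w * B) i j) w := by
  have hadd : ContDiff ℝ k fun w : ι → ℝ => e + w := contDiff_const.add contDiff_id
  have hrefl : ∀ a b, ContDiffAt ℝ k (fun w => formReflection J (e + w) a b) w := by
    intro a b
    simp only [formReflection, Matrix.sub_apply, Matrix.smul_apply, vecMulVec_apply, smul_eq_mul]
    refine contDiffAt_const.sub (ContDiffAt.mul ?_ (ContDiffAt.mul ?_ ?_))
    · exact contDiffAt_const.div ((contDiff_dotProduct_mulVec J).comp hadd).contDiffAt h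
    · exact ((contDiff_apply ℝ ℝ a).comp hadd).contDiffAt
    · exact ((contDiff_apply ℝ ℝ b).comp ((contDiff_mulVec J).comp hadd)).contDiffAt
  refine contDiffAt_pi.2 fun i => contDiffAt_pi.2 fun j => ?_
  simp only [twoReflections, Matrix.mul_apply]
  refine ContDiffAt.sum fun l _ => ContDiffAt.mul ?_ contDiffAt_const
  refine ContDiffAt.sum fun m _ => contDiffAt_const.mul ?_
  exact ContDiffAt.sum fun p _ => (hrefl m p).mul contDiffAt_const

end Reflection

/-! ### The orbit map of `X` onto the quadric -/

/-- The index type of the coordinates of `ℝ^(2+2n)`. -/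
abbrev IndexSO (n : ℕ) : Type := (Fin 1 ⊕ Fin 1) ⊕ (Fin n ⊕ Fin n)

/-- The space `ℝ^(2+2n)` on which `SO(2, 2n)` acts. -/
abbrev AmbientSpace (n : ℕ) : Type := IndexSO n → ℝ

/-- The matrix of the form of signature `(2, 2n)`. -/
abbrev formMatrix (n : ℕ) : Matrix (IndexSO n) (IndexSO n) ℝ :=
  indefiniteDiagonal (Fin 1 ⊕ Fin 1) (Fin n ⊕ Fin n) ℝ

/-- The first index. -/
abbrev firstIndex (n : ℕ) : IndexSO n := Sum.inl (Sum.inl 0)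

/-- The first vector of the standard basis. -/
def baseVector (n : ℕ) : AmbientSpace n := Pi.single (firstIndex n) 1

/-- The quadric of all vectors of square one. -/
def quadric (n : ℕ) : Set (AmbientSpace n) := {v | v ⬝ᵥ formMatrix n *ᵥ v = 1}

theorem formMatrix_transpose (n : ℕ) : (formMatrix n)ᵀ = formMatrix n := by
  rw [formMatrix, indefiniteDiagonal, diagonal_transpose]

theorem formMatrix_mulVec_baseVector (n : ℕ) : formMatrix n *ᵥ baseVector n = baseVector n := by
  ext i
  rw [formMatrix, indefiniteDiagonal, mulVec_diagonal]
  rcases i with i | i <;> simp [baseVector]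

theorem baseVector_dotProduct {n : ℕ} (v : AmbientSpace n) :
    baseVector n ⬝ᵥ formMatrix n *ᵥ v = v (firstIndex n) := by
  rw [dotProduct_mulVec, ← mulVec_transpose, formMatrix_transpose, formMatrix_mulVec_baseVector,
    baseVector, single_one_dotProduct]

theorem baseVector_form (n : ℕ) : baseVector n ⬝ᵥ formMatrix n *ᵥ baseVector n = 1 := by
  rw [baseVector_dotProduct]
  simp [baseVector]

theorem form_comm {n : ℕ} (v w : AmbientSpace n) :
    v ⬝ᵥ formMatrix n *ᵥ w = w ⬝ᵥ formMatrix n *ᵥ v := by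
  rw [dotProduct_mulVec, ← mulVec_transpose, formMatrix_transpose, dotProduct_comm]

theorem form_baseVector_add {n : ℕ} {w : AmbientSpace n} (hw : w ∈ quadric n) :
    (baseVector n + w) ⬝ᵥ formMatrix n *ᵥ (baseVector n + w) = 2 * (1 + w (firstIndex n)) := by
  have hw' : w ⬝ᵥ formMatrix n *ᵥ w = 1 := hw
  rw [mulVec_add, dotProduct_add, add_dotProduct, add_dotProduct, baseVector_form, hw',
    form_comm w, baseVector_dotProduct]
  ring

theorem GroupSO.transpose_mul {n : ℕ} (g : GroupSO n) :
    g.1.1ᵀ * formMatrix n * g.1.1 = formMatrix n := g.2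

theorem GroupSO.form_mulVec {n : ℕ} (g : GroupSO n) (v w : AmbientSpace n) :
    (g.1.1 *ᵥ v) ⬝ᵥ formMatrix n *ᵥ (g.1.1 *ᵥ w) = v ⬝ᵥ formMatrix n *ᵥ w := by
  have h := g.transpose_mul
  generalize g.1.1 = A at h ⊢
  rw [← vecMul_transpose, ← dotProduct_mulVec, mulVec_mulVec, mulVec_mulVec, h]

theorem GroupSO.mulVec_mem_quadric {n : ℕ} (g : GroupSO n) {v : AmbientSpace n}
    (hv : v ∈ quadric n) : g.1.1 *ᵥ v ∈ quadric n :=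
  (g.form_mulVec v v).trans hv

theorem GroupSO.inv_mul {n : ℕ} (g : GroupSO n) : g⁻¹.1.1 * g.1.1 = 1 :=
  congrArg (fun h : GroupSO n => h.1.1) (inv_mul_cancel g)

theorem GroupSO.mul_inv {n : ℕ} (g : GroupSO n) : g.1.1 * g⁻¹.1.1 = 1 :=
  congrArg (fun h : GroupSO n => h.1.1) (mul_inv_cancel g)

theorem GroupSO.coe_mul {n : ℕ} (g h : GroupSO n) : (g * h).1.1 = g.1.1 * h.1.1 := rfl

theorem subgroupSO_mulVec {n : ℕ} {h : GroupSO n} (hh : h ∈ subgroupSO n) :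
    h.1.1 *ᵥ baseVector n = baseVector n := by
  obtain ⟨k, rfl⟩ := hh
  ext i
  change (blockOne k.1.1 *ᵥ baseVector n) i = _
  rw [baseVector, mulVec_single_one]
  rcases i with (i | i) | i
  · obtain rfl := Subsingleton.elim i 0
    simp [blockOne]
  all_goals simp [blockOne]

theorem blockOne_injective {p q : Type*} [Fintype p] [Fintype q] [DecidableEq p] [DecidableEq q] :
    Function.Injective (blockOne : Matrix (p ⊕ q) (p ⊕ q) ℝ → _) := by
  intro A B h
  ext i j
  have h1 := congrFun (congrFun h ((Equiv.sumAssoc (Fin 1) p q).symm (Sum.inr i)))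
    ((Equiv.sumAssoc (Fin 1) p q).symm (Sum.inr j))
  simpa [blockOne] using h1

/-- Fixing `e` determines the first column; preservation of the form `J`, together with `J e = e`,
then determines the first row. What remains is a block `diag(1, k)`. -/
theorem mem_subgroupSO_of_mulVec {n : ℕ} {h : GroupSO n}
    (hh : h.1.1 *ᵥ baseVector n = baseVector n) : h ∈ subgroupSO n := by
  have hcol : ∀ i, h.1.1 i (firstIndex n) = baseVector n i := by
    intro i
    rw [← hh, baseVector, mulVec_single_one]
    rfl
  have hrow : ∀ j, h.1.1 (firstIndex n) j = baseVector n j := by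
    have h1 : h.1.1ᵀ *ᵥ baseVector n = baseVector n := by
      have h2 := congrArg (fun A => A *ᵥ baseVector n) h.transpose_mul
      simp only [← mulVec_mulVec, hh, formMatrix_mulVec_baseVector] at h2
      exact h2
    intro j
    rw [← h1, baseVector, mulVec_single_one]
    rfl
  let k : Matrix (Fin 1 ⊕ (Fin n ⊕ Fin n)) (Fin 1 ⊕ (Fin n ⊕ Fin n)) ℝ :=
    fun i j => h.1.1 ((Equiv.sumAssoc (Fin 1) _ _).symm (Sum.inr i))
      ((Equiv.sumAssoc (Fin 1) _ _).symm (Sum.inr j))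
  have hk : blockOne k = h.1.1 := by
    ext i j
    by_cases hi : i = firstIndex n
    · subst hi
      rw [hrow]
      rcases j with (j | j) | j
      · obtain rfl := Subsingleton.elim j 0
        simp [blockOne, baseVector]
      all_goals simp [blockOne, baseVector]
    by_cases hj : j = firstIndex n
    · subst hj
      rw [hcol]
      rcases i with (i | i) | i
      · exact absurd (by rw [Subsingleton.elim i 0]) hi
      all_goals simp [blockOne, baseVector]
    rcases i with (i | i) | i
    · exact absurd (by rw [Subsingleton.elim i 0]) hi
    all_goals
      rcases j with (j | j) | j
      · exact absurd (by rw [Subsingleton.elim j 0]) hj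
      all_goals rfl
  refine ⟨⟨⟨k, ?_⟩, ?_⟩, ?_⟩
  · rw [← blockOne_det, hk]
    exact h.1.2
  · apply blockOne_injective
    change blockOne (kᵀ * indefiniteDiagonal (Fin 1) (Fin n ⊕ Fin n) ℝ * k) = _
    rw [blockOne_mul, blockOne_mul, ← blockOne_transpose, blockOne_indefiniteDiagonal, hk]
    exact h.2
  · exact Subtype.ext (Subtype.ext hk)

/-- The map `gH ↦ g e` of `X` to `ℝ^(2+2n)`, for the first vector `e` of the standard basis. -/
def orbitMap (n : ℕ) : HomogSpace n → AmbientSpace n :=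
  Quotient.lift (fun g : GroupSO n => g.1.1 *ᵥ baseVector n) fun a b hab => by
    have h := subgroupSO_mulVec (QuotientGroup.leftRel_apply.1 hab)
    rw [GroupSO.coe_mul, ← mulVec_mulVec] at h
    have h2 := congrArg (fun v => a.1.1 *ᵥ v) h
    simp only [mulVec_mulVec, ← Matrix.mul_assoc, a.mul_inv, Matrix.one_mul] at h2
    exact h2.symm

variable {n : ℕ}

@[simp]
theorem orbitMap_mk (g : GroupSO n) :
    orbitMap n (QuotientGroup.mk g) = g.1.1 *ᵥ baseVector n := rfl

theorem orbitMap_smul (g : GroupSO n) (x : HomogSpace n) :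
    orbitMap n (g • x) = g.1.1 *ᵥ orbitMap n x := by
  induction x using QuotientGroup.induction_on with
  | H h =>
    change orbitMap n (QuotientGroup.mk (g * h)) = _
    rw [orbitMap_mk, orbitMap_mk, mulVec_mulVec, GroupSO.coe_mul]

theorem baseVector_mem_quadric (n : ℕ) : baseVector n ∈ quadric n := baseVector_form n

theorem orbitMap_mem_quadric (x : HomogSpace n) : orbitMap n x ∈ quadric n := by
  induction x using QuotientGroup.induction_on with
  | H h => exact h.mulVec_mem_quadric (baseVector_mem_quadric n)

theorem orbitMap_injective (n : ℕ) : Function.Injective (orbitMap n) := by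
  intro x y hxy
  induction x using QuotientGroup.induction_on with
  | H g =>
  induction y using QuotientGroup.induction_on with
  | H h =>
    rw [orbitMap_mk, orbitMap_mk] at hxy
    refine QuotientGroup.eq.2 (mem_subgroupSO_of_mulVec ?_)
    rw [GroupSO.coe_mul, ← mulVec_mulVec, ← hxy, mulVec_mulVec, g.inv_mul, one_mulVec]

/-! ### Local sections and the identification of `X` with the quadric. -/

/-- A matrix depending smoothly on `w` near `g e`, which lies in `SO(2, 2n)` and maps `e` to `w` if
`w` lies on the quadric. -/
noncomputable def localSection (g : GroupSO n) (w : AmbientSpace n) :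
    Matrix (IndexSO n) (IndexSO n) ℝ :=
  g.1.1 * twoReflections (formMatrix n) (baseVector n) (g⁻¹.1.1 *ᵥ w)

/-- The set on which `localSection g` is smooth. -/
def sectionDomain (g : GroupSO n) : Set (AmbientSpace n) :=
  {w | (baseVector n + g⁻¹.1.1 *ᵥ w) ⬝ᵥ formMatrix n *ᵥ (baseVector n + g⁻¹.1.1 *ᵥ w) ≠ 0}

theorem isOpen_sectionDomain (g : GroupSO n) : IsOpen (sectionDomain g) := by
  refine IsOpen.preimage (t := {0}ᶜ) ?_ isOpen_compl_singleton
  exact (continuous_form (formMatrix n)).comp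
    (continuous_const.add (contDiff_mulVec (k := 0) g⁻¹.1.1).continuous)

theorem mulVec_baseVector_mem_sectionDomain (g : GroupSO n) :
    g.1.1 *ᵥ baseVector n ∈ sectionDomain g := by
  rw [sectionDomain, Set.mem_ofPred_eq, mulVec_mulVec, g.inv_mul, one_mulVec,
    form_baseVector_add (baseVector_mem_quadric n)]
  norm_num [baseVector]

theorem contDiffAt_localSection (g : GroupSO n) {w : AmbientSpace n} (hw : w ∈ sectionDomain g)
    {k : WithTop ℕ∞} : ContDiffAt ℝ k (fun w i j => localSection g w i j) w := by
  have h := contDiffAt_twoReflections (J := formMatrix n) (e := baseVector n)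
    (w := g⁻¹.1.1 *ᵥ w) hw g.1.1 1 (k := k)
  simp only [mul_one] at h
  exact ContDiffAt.comp (g := fun w i j => (g.1.1 * twoReflections (formMatrix n)
    (baseVector n) w) i j) w h (contDiff_mulVec _).contDiffAt

/-- The element of `SO(2, 2n)` given by `localSection`. -/
noncomputable def groupSection (g : GroupSO n) (w : AmbientSpace n) (hw : w ∈ sectionDomain g) :
    GroupSO n :=
  g * ⟨⟨twoReflections (formMatrix n) (baseVector n) (g⁻¹.1.1 *ᵥ w),
    det_twoReflections (by rw [baseVector_form]; exact one_ne_zero) hw⟩,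
    transpose_twoReflections_mul (formMatrix_transpose n)
      (by rw [baseVector_form]; exact one_ne_zero) hw⟩

theorem groupSection_coe (g : GroupSO n) (w : AmbientSpace n) (hw : w ∈ sectionDomain g) :
    (groupSection g w hw).1.1 = localSection g w := rfl

theorem localSection_mulVec (g : GroupSO n) {w : AmbientSpace n} (hw : w ∈ sectionDomain g)
    (hq : w ∈ quadric n) : localSection g w *ᵥ baseVector n = w := by
  rw [localSection, ← mulVec_mulVec, twoReflections_mulVec (formMatrix_transpose n)
    (baseVector_form n) (g⁻¹.mulVec_mem_quadric hq) hw, mulVec_mulVec, g.mul_inv, one_mulVec]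

theorem localSection_mulVec_baseVector (g : GroupSO n) :
    localSection g (g.1.1 *ᵥ baseVector n) = g.1.1 := by
  rw [localSection, mulVec_mulVec, g.inv_mul, one_mulVec,
    twoReflections_self (baseVector_form n), mul_one]

theorem mk_groupSection (g : GroupSO n) {x : HomogSpace n} (hx : orbitMap n x ∈ sectionDomain g) :
    QuotientGroup.mk (groupSection g (orbitMap n x) hx) = x := by
  apply orbitMap_injective
  rw [orbitMap_mk, groupSection_coe, localSection_mulVec g hx (orbitMap_mem_quadric x)]

/-- The section at the identity reaches every `w` in the quadric with first coordinate different
from `-1`, since `e + w` has square `2 (1 + w₀)`. The other vectors are negatives of such. -/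
theorem range_orbitMap (n : ℕ) : range (orbitMap n) = quadric n := by
  refine Subset.antisymm (range_subset_iff.2 orbitMap_mem_quadric) fun v hv => ?_
  have key : ∀ w ∈ quadric n, w (firstIndex n) ≠ -1 → w ∈ range (orbitMap n) := by
    intro w hw h1
    have hd : w ∈ sectionDomain (1 : GroupSO n) := by
      rw [sectionDomain, Set.mem_ofPred_eq, inv_one]
      change (baseVector n + (1 : Matrix _ _ ℝ) *ᵥ w) ⬝ᵥ
        formMatrix n *ᵥ (baseVector n + (1 : Matrix _ _ ℝ) *ᵥ w) ≠ 0
      rw [one_mulVec, form_baseVector_add hw]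
      exact mul_ne_zero two_ne_zero fun h => h1 (by linarith)
    refine ⟨QuotientGroup.mk (groupSection 1 w hd), ?_⟩
    rw [orbitMap_mk, groupSection_coe, localSection_mulVec _ hd hw]
  by_cases h1 : v (firstIndex n) = -1
  · have hv' : -v ∈ quadric n := by
      change -v ⬝ᵥ formMatrix n *ᵥ (-v) = 1
      rw [mulVec_neg, neg_dotProduct_neg]
      exact hv
    obtain ⟨x, hx⟩ := key (-v) hv' (by rw [Pi.neg_apply, h1]; norm_num)
    -- The ambient dimension `2 + 2n` is even, so `-1` has determinant one.
    let m : GroupSO n := ⟨⟨-1, by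
      rw [det_neg, det_one, mul_one]
      refine Even.neg_one_pow ?_
      simp only [Fintype.card_sum, Fintype.card_fin]
      exact ⟨1 + n, by ring⟩⟩, by
        change (-1 : Matrix _ _ ℝ)ᵀ * formMatrix n * -1 = formMatrix n
        simp⟩
    refine ⟨m • x, ?_⟩
    rw [orbitMap_smul, hx]
    change (-1 : Matrix _ _ ℝ) *ᵥ -v = v
    simp [neg_mulVec]
  · exact key v hv h1

theorem continuous_orbitMap (n : ℕ) : Continuous (orbitMap n) := by
  refine continuous_quot_lift _ ?_
  have h : Continuous fun g : GroupSO n => g.1.1 :=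
    continuous_subtype_val.comp continuous_subtype_val
  exact h.matrix_mulVec continuous_const

/-- If the image of `y` tends to `g e`, then the section evaluated there tends to `g`, and its
class, which is `y`, tends to `gH`. -/
theorem isInducing_orbitMap (n : ℕ) : IsInducing (orbitMap n) := by
  refine isInducing_iff_nhds.2 fun x => le_antisymm
    ((continuous_orbitMap n).tendsto x).le_comap ?_
  induction x using QuotientGroup.induction_on with
  | H g =>
  classical
  -- The default value `1` is harmless: the section domain is a neighbourhood of `g e`.
  let s : HomogSpace n → GroupSO n := fun y =>
    if h : orbitMap n y ∈ sectionDomain g then groupSection g (orbitMap n y) h else 1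
  have hdom : ∀ᶠ y in comap (orbitMap n) (𝓝 (orbitMap n (QuotientGroup.mk g))),
      orbitMap n y ∈ sectionDomain g :=
    tendsto_comap.eventually ((isOpen_sectionDomain g).mem_nhds
      (mulVec_baseVector_mem_sectionDomain g))
  have hs : Tendsto s (comap (orbitMap n) (𝓝 (orbitMap n (QuotientGroup.mk g)))) (𝓝 g) := by
    refine tendsto_subtype_rng.2 (tendsto_subtype_rng
      (p := fun A : Matrix (IndexSO n) (IndexSO n) ℝ => A.det = 1).2 ?_)
    have h1 : Tendsto (fun w => localSection g w)
        (𝓝 (orbitMap n (QuotientGroup.mk g))) (𝓝 g.1.1) := by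
      have h2 := (contDiffAt_localSection g (k := 0)
        (mulVec_baseVector_mem_sectionDomain g)).continuousAt
      have h3 : Tendsto (fun w => localSection g w) (𝓝 (g.1.1 *ᵥ baseVector n))
        (𝓝 (localSection g (g.1.1 *ᵥ baseVector n))) := h2
      rwa [localSection_mulVec_baseVector] at h3
    refine (h1.comp tendsto_comap).congr' ?_
    filter_upwards [hdom] with y hy
    simp only [Function.comp, s, dif_pos hy]
    rfl
  have hmk : Tendsto (fun y => (QuotientGroup.mk (s y) : HomogSpace n))
      (comap (orbitMap n) (𝓝 (orbitMap n (QuotientGroup.mk g)))) (𝓝 (QuotientGroup.mk g)) :=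
    (QuotientGroup.continuous_mk.tendsto g).comp hs
  have hid : Tendsto id
      (comap (orbitMap n) (𝓝 (orbitMap n (QuotientGroup.mk g)))) (𝓝 (QuotientGroup.mk g)) := by
    refine hmk.congr' ?_
    filter_upwards [hdom] with y hy
    simp only [s, dif_pos hy]
    exact mk_groupSection g hy
  exact tendsto_id'.1 hid

theorem isEmbedding_orbitMap (n : ℕ) : IsEmbedding (orbitMap n) :=
  ⟨isInducing_orbitMap n, orbitMap_injective n⟩

/-- A function with smooth pullback to the group is near each point the restriction of a smooth
function on `ℝ^(2+2n)`. -/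
theorem SmoothOnGroup.exists_extension {U : Set (HomogSpace n)} {f : HomogSpace n → ℝ}
    (hf : SmoothOnGroup (fun g => f (QuotientGroup.mk g)) (QuotientGroup.mk ⁻¹' U))
    {x : HomogSpace n} (hx : x ∈ U) :
    ∃ O : Set (AmbientSpace n), IsOpen O ∧ orbitMap n x ∈ O ∧
      ∃ F : AmbientSpace n → ℝ, ContDiffOn ℝ ∞ F O ∧
        ∀ y ∈ U, orbitMap n y ∈ O → f y = F (orbitMap n y) := by
  induction x using QuotientGroup.induction_on with
  | H g =>
  obtain ⟨V, hV, hgV, F, hF, hfF⟩ := hf g hx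
  -- Composing the extension `F` to matrices with the local section turns it into a function of the
  -- point of the quadric.
  let σ : AmbientSpace n → IndexSO n → IndexSO n → ℝ := fun w i j => localSection g w i j
  have hσ : ContDiffOn ℝ ∞ σ (sectionDomain g) := fun w hw =>
    (contDiffAt_localSection g hw).contDiffWithinAt
  refine ⟨sectionDomain g ∩ σ ⁻¹' V, hσ.continuousOn.isOpen_inter_preimage
    (isOpen_sectionDomain g) hV, ⟨mulVec_baseVector_mem_sectionDomain g, ?_⟩, F ∘ σ, ?_, ?_⟩
  · change σ (g.1.1 *ᵥ baseVector n) ∈ V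
    simp only [σ, localSection_mulVec_baseVector]
    exact hgV
  · exact hF.comp (hσ.mono inter_subset_left) fun w hw => hw.2
  · intro y hy hyO
    have hmk := mk_groupSection g hyO.1
    have h1 := hfF (groupSection g (orbitMap n y) hyO.1)
      (by rw [Set.mem_preimage, hmk]; exact hy) hyO.2
    exact (congrArg f hmk).symm.trans h1

/-! ### The standard smooth structure -/

/-- The model space of `X`. -/
abbrev ModelVector (n : ℕ) : Type := EuclideanSpace ℝ (Fin (2 * n + 1))

/-- The coordinates in `ℝ^(2+2n)` except the first, as a vector of the model space. -/
noncomputable def remainingCoordinatesEquiv (n : ℕ) :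
    ({i : IndexSO n // i ≠ firstIndex n} → ℝ) ≃L[ℝ] ModelVector n :=
  ContinuousLinearEquiv.ofFinrankEq (by
    rw [Module.finrank_fintype_fun_eq_card, finrank_euclideanSpace_fin, Fintype.card_subtype_compl]
    simp only [Fintype.card_sum, Fintype.card_fin, Fintype.card_subtype_eq]
    omega)

/-- The projection of `ℝ^(2+2n)` forgetting the first coordinate. -/
noncomputable def forgetFirst (n : ℕ) : AmbientSpace n →L[ℝ] ModelVector n :=
  (remainingCoordinatesEquiv n).toContinuousLinearMap.comp
    (ContinuousLinearMap.pi fun i : {i : IndexSO n // i ≠ firstIndex n} =>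
      ContinuousLinearMap.proj i.1)

/-- The inclusion of the vectors with vanishing first coordinate. -/
noncomputable def insertZero (n : ℕ) : ModelVector n →L[ℝ] AmbientSpace n :=
  (ContinuousLinearMap.pi fun i : IndexSO n => if h : i ≠ firstIndex n then
      ContinuousLinearMap.proj (⟨i, h⟩ : {i : IndexSO n // i ≠ firstIndex n})
    else 0).comp (remainingCoordinatesEquiv n).symm.toContinuousLinearMap

theorem insertZero_firstIndex (y : ModelVector n) : insertZero n y (firstIndex n) = 0 := by
  simp [insertZero]

theorem forgetFirst_insertZero (y : ModelVector n) : forgetFirst n (insertZero n y) = y := by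
  rw [forgetFirst, ContinuousLinearMap.comp_apply, ContinuousLinearEquiv.coe_coe,
    ← ContinuousLinearEquiv.eq_symm_apply]
  ext i
  simp [insertZero, i.2]

theorem forgetFirst_baseVector (n : ℕ) : forgetFirst n (baseVector n) = 0 := by
  rw [forgetFirst, ContinuousLinearMap.comp_apply, ContinuousLinearEquiv.coe_coe,
    ContinuousLinearEquiv.map_eq_zero_iff]
  ext i
  simp [baseVector, i.2]

theorem insertZero_forgetFirst (v : AmbientSpace n) :
    insertZero n (forgetFirst n v) + v (firstIndex n) • baseVector n = v := by
  ext i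
  by_cases h : i = firstIndex n
  · subst h
    simp [insertZero, baseVector]
  · simp [insertZero, forgetFirst, h, baseVector]

/-- The value of the quadratic form on the vectors with vanishing first coordinate. -/
noncomputable def partialForm (y : ModelVector n) : ℝ :=
  insertZero n y ⬝ᵥ formMatrix n *ᵥ insertZero n y

theorem contDiff_partialForm {k : WithTop ℕ∞} : ContDiff ℝ k (partialForm (n := n)) :=
  (contDiff_dotProduct_mulVec (formMatrix n)).comp (insertZero n).contDiff

theorem form_insertZero_add (y : ModelVector n) (t : ℝ) :
    (insertZero n y + t • baseVector n) ⬝ᵥ formMatrix n *ᵥ (insertZero n y + t • baseVector n)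
      = partialForm y + t ^ 2 := by
  rw [mulVec_add, mulVec_smul, dotProduct_add, add_dotProduct, add_dotProduct, smul_dotProduct,
    dotProduct_smul, smul_dotProduct, dotProduct_smul, form_comm (insertZero n y) (baseVector n),
    baseVector_form, baseVector_dotProduct, insertZero_firstIndex, partialForm]
  simp only [smul_eq_mul]
  ring

/-- The vector of the quadric with positive first coordinate and the given further coordinates. -/
noncomputable def quadricPoint (y : ModelVector n) : AmbientSpace n :=
  insertZero n y + Real.sqrt (1 - partialForm y) • baseVector n

/-- The set of all `y` for which `quadricPoint y` lies on the quadric, with positive first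
coordinate. -/
def chartTarget (n : ℕ) : Set (ModelVector n) := {y | partialForm y < 1}

theorem isOpen_chartTarget (n : ℕ) : IsOpen (chartTarget n) :=
  isOpen_lt (contDiff_partialForm (k := 0)).continuous continuous_const

theorem quadricPoint_mem_quadric {y : ModelVector n} (hy : y ∈ chartTarget n) :
    quadricPoint y ∈ quadric n := by
  change _ = (1 : ℝ)
  rw [quadricPoint, form_insertZero_add, Real.sq_sqrt (sub_nonneg.2 (le_of_lt hy))]
  ring

theorem quadricPoint_firstIndex (y : ModelVector n) :
    quadricPoint y (firstIndex n) = Real.sqrt (1 - partialForm y) := by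
  simp [quadricPoint, insertZero_firstIndex, baseVector]

theorem forgetFirst_quadricPoint (y : ModelVector n) : forgetFirst n (quadricPoint y) = y := by
  rw [quadricPoint, map_add, map_smul, forgetFirst_insertZero, forgetFirst_baseVector, smul_zero,
    add_zero]

theorem partialForm_forgetFirst {v : AmbientSpace n} (hv : v ∈ quadric n) :
    partialForm (forgetFirst n v) = 1 - v (firstIndex n) ^ 2 := by
  have h := form_insertZero_add (forgetFirst n v) (v (firstIndex n))
  rw [insertZero_forgetFirst] at h
  have hv' : v ⬝ᵥ formMatrix n *ᵥ v = 1 := hv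
  linarith

theorem quadricPoint_forgetFirst {v : AmbientSpace n} (hv : v ∈ quadric n)
    (h : 0 < v (firstIndex n)) : quadricPoint (forgetFirst n v) = v := by
  rw [quadricPoint, partialForm_forgetFirst hv, sub_sub_cancel, Real.sqrt_sq h.le,
    insertZero_forgetFirst]

theorem contDiffOn_quadricPoint {k : WithTop ℕ∞} :
    ContDiffOn ℝ k (quadricPoint (n := n)) (chartTarget n) := by
  have h : ContDiffOn ℝ k (fun y : ModelVector n => Real.sqrt (1 - partialForm y))
      (chartTarget n) :=
    (contDiff_const.sub contDiff_partialForm).contDiffOn.sqrt fun y hy => (sub_pos.2 hy).ne'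
  exact (insertZero n).contDiff.contDiffOn.add (h.smul contDiffOn_const)

/-- The chart of `X` given by all coordinates in `ℝ^(2+2n)` except the first. -/
noncomputable def baseChart (n : ℕ) : OpenPartialHomeomorph (HomogSpace n) (ModelVector n) where
  toFun x := forgetFirst n (orbitMap n x)
  -- The arbitrary values of `Function.invFun` off the quadric play no role, since `quadricPoint`
  -- maps `chartTarget n` into it.
  invFun y := Function.invFun (orbitMap n) (quadricPoint y)
  source := {x | 0 < orbitMap n x (firstIndex n)}
  target := chartTarget n
  map_source' x hx := by
    change partialForm _ < 1
    rw [partialForm_forgetFirst (orbitMap_mem_quadric x)]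
    have hx' : 0 < orbitMap n x (firstIndex n) := hx
    have := pow_pos hx' 2
    linarith
  map_target' y hy := by
    have h : orbitMap n (Function.invFun (orbitMap n) (quadricPoint y)) = quadricPoint y :=
      Function.invFun_eq ((range_orbitMap n).ge (quadricPoint_mem_quadric hy))
    change 0 < orbitMap n _ _
    rw [h, quadricPoint_firstIndex]
    exact Real.sqrt_pos.2 (sub_pos.2 hy)
  left_inv' x hx := by
    rw [quadricPoint_forgetFirst (orbitMap_mem_quadric x) hx]
    exact Function.leftInverse_invFun (orbitMap_injective n) x
  right_inv' y hy := by
    have h : orbitMap n (Function.invFun (orbitMap n) (quadricPoint y)) = quadricPoint y :=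
      Function.invFun_eq ((range_orbitMap n).ge (quadricPoint_mem_quadric hy))
    rw [h, forgetFirst_quadricPoint]
  open_source := isOpen_lt continuous_const
    ((continuous_apply (firstIndex n)).comp (continuous_orbitMap n))
  open_target := isOpen_chartTarget n
  continuousOn_toFun := ((forgetFirst n).continuous.comp (continuous_orbitMap n)).continuousOn
  continuousOn_invFun := by
    rw [(isInducing_orbitMap n).continuousOn_iff]
    refine (contDiffOn_quadricPoint (k := 0)).continuousOn.congr fun y hy => ?_
    exact Function.invFun_eq ((range_orbitMap n).ge (quadricPoint_mem_quadric hy))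

theorem orbitMap_baseChart_symm {y : ModelVector n} (hy : y ∈ chartTarget n) :
    orbitMap n ((baseChart n).symm y) = quadricPoint y :=
  Function.invFun_eq ((range_orbitMap n).ge (quadricPoint_mem_quadric hy))

/-- The translate of the chart `baseChart n` by `g`. -/
noncomputable def translatedChart (g : GroupSO n) :
    OpenPartialHomeomorph (HomogSpace n) (ModelVector n) :=
  (Homeomorph.smul g⁻¹).transOpenPartialHomeomorph (baseChart n)

theorem translatedChart_apply (g : GroupSO n) (x : HomogSpace n) :
    translatedChart g x = forgetFirst n (g⁻¹.1.1 *ᵥ orbitMap n x) := by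
  rw [← orbitMap_smul]
  rfl

theorem mem_translatedChart_source {g : GroupSO n} {x : HomogSpace n} :
    x ∈ (translatedChart g).source ↔ 0 < (g⁻¹.1.1 *ᵥ orbitMap n x) (firstIndex n) := by
  rw [← orbitMap_smul]
  rfl

theorem orbitMap_translatedChart_symm (g : GroupSO n) {y : ModelVector n} (hy : y ∈ chartTarget n) :
    orbitMap n ((translatedChart g).symm y) = g.1.1 *ᵥ quadricPoint y := by
  have h : (translatedChart g).symm y = g • (baseChart n).symm y := by
    change (g⁻¹)⁻¹ • (baseChart n).symm y = _
    rw [inv_inv]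
  rw [h, orbitMap_smul, orbitMap_baseChart_symm hy]

theorem mk_mem_translatedChart_source (g : GroupSO n) :
    QuotientGroup.mk g ∈ (translatedChart g).source := by
  rw [mem_translatedChart_source, orbitMap_mk, mulVec_mulVec, g.inv_mul, one_mulVec]
  simp [baseVector]

/-- The charted space structure of `X` given by the translates of `baseChart n`. -/
@[reducible]
noncomputable def homogSpaceChartedSpace (n : ℕ) :
    ChartedSpace (ModelVector n) (HomogSpace n) where
  atlas := range translatedChart
  chartAt x := translatedChart (Quotient.out x)
  mem_chart_source x := by
    have h := mk_mem_translatedChart_source (Quotient.out x)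
    rwa [QuotientGroup.out_eq'] at h
  chart_mem_atlas x := mem_range_self _

/-- A transition map is `quadricPoint`, smooth because its square root is taken of a positive
number, followed by linear maps. -/
theorem homogSpace_isManifold (n : ℕ) :
    letI := homogSpaceChartedSpace n
    IsManifold (𝓡 (2 * n + 1)) ∞ (HomogSpace n) := by
  let := homogSpaceChartedSpace n
  refine isManifold_of_contDiffOn _ _ _ ?_
  rintro _ _ ⟨g, rfl⟩ ⟨h, rfl⟩
  simp only [modelWithCornersSelf_coe, modelWithCornersSelf_coe_symm, preimage_id,
    range_id, inter_univ, CompTriple.comp_eq]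
  have h1 : ContDiffOn ℝ ∞ (fun y => forgetFirst n (h⁻¹.1.1 *ᵥ (g.1.1 *ᵥ quadricPoint y)))
      (chartTarget n) :=
    (forgetFirst n).contDiff.comp_contDiffOn ((contDiff_mulVec _).comp_contDiffOn
      ((contDiff_mulVec _).comp_contDiffOn contDiffOn_quadricPoint))
  refine (h1.mono fun y hy => ?_).congr fun y hy => ?_
  · exact hy.1
  · rw [OpenPartialHomeomorph.coe_trans, Function.comp_apply, translatedChart_apply,
      orbitMap_translatedChart_symm g hy.1]

theorem contMDiff_orbitMap_standard (n : ℕ) :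
    letI := homogSpaceChartedSpace n
    ContMDiff (𝓡 (2 * n + 1)) 𝓘(ℝ, AmbientSpace n) ∞ (orbitMap n) := by
  let := homogSpaceChartedSpace n
  have := homogSpace_isManifold n
  intro x
  set g : GroupSO n := Quotient.out x with hg
  have hx : x ∈ (translatedChart g).source := mem_chart_source (ModelVector n) x
  have h1 : ContMDiffOn (𝓡 (2 * n + 1)) (𝓡 (2 * n + 1)) ∞ (translatedChart g)
      (translatedChart g).source := contMDiffOn_chart (x := x)
  have h2 : ContMDiffOn (𝓡 (2 * n + 1)) 𝓘(ℝ, AmbientSpace n) ∞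
      (fun y => g.1.1 *ᵥ quadricPoint y) (chartTarget n) :=
    ((contDiff_mulVec _).comp_contDiffOn contDiffOn_quadricPoint).contMDiffOn
  have h3 := h2.comp h1 fun y hy => (translatedChart g).map_source hy
  refine ((h3.congr fun y hy => ?_).contMDiffAt ((translatedChart g).open_source.mem_nhds hx))
  have h4 := orbitMap_translatedChart_symm g ((translatedChart g).map_source hy)
  rw [(translatedChart g).left_inv hy] at h4
  exact h4

theorem homogSpace_isHomogeneousSmoothStructure (n : ℕ) :
    letI := homogSpaceChartedSpace n
    IsHomogeneousSmoothStructure n := by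
  let := homogSpaceChartedSpace n
  have := homogSpace_isManifold n
  refine ⟨homogSpace_isManifold n, fun U hU f => ⟨fun hf g hg => ?_, fun hf x hx => ?_⟩⟩
  · have hatlas : translatedChart g ∈ IsManifold.maximalAtlas (𝓡 (2 * n + 1)) ∞ (HomogSpace n) :=
      IsManifold.subset_maximalAtlas (mem_range_self g)
    set c := translatedChart g with hc
    have h1 : ContDiffOn ℝ ∞ (f ∘ c.symm) (c.target ∩ c.symm ⁻¹' U) :=
      (hf.comp ((contMDiffOn_symm_of_mem_maximalAtlas hatlas).mono inter_subset_left)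
        fun y hy => hy.2).contDiffOn
    -- The chart at `gH`, pulled back to the group, is `forgetFirst n ∘ σ`, which is linear in the
    -- matrix entries and so extends to all matrices.
    let σ : (IndexSO n → IndexSO n → ℝ) → AmbientSpace n := fun A =>
      g⁻¹.1.1 *ᵥ (Matrix.of A *ᵥ baseVector n)
    have hσ : ContDiff ℝ ∞ σ := by
      refine (contDiff_mulVec _).comp (contDiff_pi.2 fun i => ?_)
      simp only [mulVec, dotProduct]
      refine ContDiff.sum fun j _ => ContDiff.mul ?_ contDiff_const
      exact contDiff_apply_apply ℝ ℝ i j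
    have hσ' : ContDiff ℝ ∞ fun A => forgetFirst n (σ A) := (forgetFirst n).contDiff.comp hσ
    have hmem : ∀ h : GroupSO n, QuotientGroup.mk h ∈ c.source →
        forgetFirst n (σ fun i j => h.1.1 i j) = c (QuotientGroup.mk h) := by
      intro h _
      rw [hc, translatedChart_apply]
      rfl
    -- The positivity condition selects the correct sheet: the remaining coordinates determine the
    -- first one only up to sign.
    refine ⟨{A | 0 < σ A (firstIndex n)} ∩
      (fun A => forgetFirst n (σ A)) ⁻¹' (c.target ∩ c.symm ⁻¹' U), ?_, ?_,
      fun A => f (c.symm (forgetFirst n (σ A))), ?_, ?_⟩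
    · refine (isOpen_lt continuous_const ((continuous_apply _).comp hσ.continuous)).inter ?_
      exact (c.symm.isOpen_inter_preimage hU).preimage hσ'.continuous
    · have hs : QuotientGroup.mk g ∈ c.source := mk_mem_translatedChart_source g
      refine ⟨mem_translatedChart_source.1 hs, ?_⟩
      rw [Set.mem_preimage, hmem g hs]
      refine ⟨c.map_source hs, ?_⟩
      rw [Set.mem_preimage, c.left_inv hs]
      exact hg
    · exact h1.comp hσ'.contDiffOn fun A hA => hA.2
    · intro h _ hV
      have hs : QuotientGroup.mk h ∈ c.source := mem_translatedChart_source.2 hV.1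
      change _ = f (c.symm _)
      rw [hmem h hs, c.left_inv hs]
  · obtain ⟨O, hO, hxO, F, hF, hfF⟩ := hf.exists_extension hx
    have h1 : ContMDiffAt 𝓘(ℝ, AmbientSpace n) 𝓘(ℝ, ℝ) ∞ F (orbitMap n x) :=
      (hF.contDiffAt (hO.mem_nhds hxO)).contMDiffAt
    refine ((h1.comp x (contMDiff_orbitMap_standard n x)).congr_of_eventuallyEq
      ?_).contMDiffWithinAt
    filter_upwards [hU.mem_nhds hx,
      (hO.preimage (continuous_orbitMap n)).mem_nhds hxO] with y hy hyO
    exact hfF y hy hyO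

/-! ### The Hermitian form and the invariant metric on the quadric -/

/-- The matrix of the Hermitian form of signature `(1, n)`. -/
abbrev hermitianMatrix (n : ℕ) : Matrix (Fin 1 ⊕ Fin n) (Fin 1 ⊕ Fin n) ℂ :=
  indefiniteDiagonal (Fin 1) (Fin n) ℂ

/-- The Hermitian form of signature `(1, n)`. -/
noncomputable def hermitianForm (z w : Fin 1 ⊕ Fin n → ℂ) : ℂ := star z ⬝ᵥ hermitianMatrix n *ᵥ w

/-- The identification of `ℝ^(2+2n)` with `ℂ^(1+n)`. -/
def complexify (v : AmbientSpace n) : Fin 1 ⊕ Fin n → ℂ :=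
  Sum.elim (fun i => ⟨v (Sum.inl (Sum.inl i)), v (Sum.inl (Sum.inr i))⟩)
    fun j => ⟨v (Sum.inr (Sum.inl j)), v (Sum.inr (Sum.inr j))⟩

theorem complexify_injective (n : ℕ) : Function.Injective (complexify (n := n)) := by
  intro v w h
  ext i
  rcases i with (i | i) | (i | i)
  · exact congrArg Complex.re (congrFun h (Sum.inl i))
  · exact congrArg Complex.im (congrFun h (Sum.inl i))
  · exact congrArg Complex.re (congrFun h (Sum.inr i))
  · exact congrArg Complex.im (congrFun h (Sum.inr i))

theorem complexify_realify_mulVec (A : Matrix (Fin 1 ⊕ Fin n) (Fin 1 ⊕ Fin n) ℂ)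
    (v : AmbientSpace n) : complexify (realify A *ᵥ v) = A *ᵥ complexify v := by
  ext k
  rcases k with k | k <;> apply Complex.ext <;>
  · simp [complexify, mulVec, dotProduct, realify, Fintype.sum_sum_type,
      Finset.sum_sub_distrib, Finset.sum_add_distrib, Complex.re_sum, Complex.im_sum]
    ring

theorem complexify_baseVector (n : ℕ) :
    complexify (baseVector n) = Pi.single (Sum.inl 0) 1 := by
  ext k
  rcases k with k | k
  · obtain rfl := Subsingleton.elim k 0
    apply Complex.ext <;> simp [complexify, baseVector]
  · apply Complex.ext <;> simp [complexify, baseVector]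

theorem hermitianForm_eq (z w : Fin 1 ⊕ Fin n → ℂ) :
    hermitianForm z w = star (z (Sum.inl 0)) * w (Sum.inl 0)
      - ∑ j, star (z (Sum.inr j)) * w (Sum.inr j) := by
  simp [hermitianForm, indefiniteDiagonal, mulVec_diagonal, dotProduct, Fintype.sum_sum_type,
    sub_eq_add_neg]

theorem form_eq_re_hermitianForm (v w : AmbientSpace n) :
    v ⬝ᵥ formMatrix n *ᵥ w = (hermitianForm (complexify v) (complexify w)).re := by
  rw [hermitianForm_eq]
  simp [indefiniteDiagonal, mulVec_diagonal, dotProduct, Fintype.sum_sum_type, complexify,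
    Complex.re_sum, Finset.sum_add_distrib]
  ring

theorem hermitianForm_sub_right (z w w' : Fin 1 ⊕ Fin n → ℂ) :
    hermitianForm z (w - w') = hermitianForm z w - hermitianForm z w' := by
  rw [hermitianForm, mulVec_sub, dotProduct_sub]
  rfl

theorem hermitianForm_smul_right (z w : Fin 1 ⊕ Fin n → ℂ) (c : ℂ) :
    hermitianForm z (c • w) = c * hermitianForm z w := by
  rw [hermitianForm, mulVec_smul, dotProduct_smul]
  rfl

theorem star_hermitianForm (z w : Fin 1 ⊕ Fin n → ℂ) :
    star (hermitianForm z w) = hermitianForm w z := by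
  rw [hermitianForm_eq, hermitianForm_eq]
  simp [mul_comm]

theorem hermitianForm_sub_left (z z' w : Fin 1 ⊕ Fin n → ℂ) :
    hermitianForm (z - z') w = hermitianForm z w - hermitianForm z' w := by
  rw [← star_hermitianForm, hermitianForm_sub_right, star_sub, star_hermitianForm,
    star_hermitianForm]

theorem hermitianForm_smul_left (z w : Fin 1 ⊕ Fin n → ℂ) (c : ℂ) :
    hermitianForm (c • z) w = star c * hermitianForm z w := by
  rw [← star_hermitianForm, hermitianForm_smul_right, star_mul', star_hermitianForm]

theorem hermitianForm_self_im (z : Fin 1 ⊕ Fin n → ℂ) : (hermitianForm z z).im = 0 :=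
  Complex.conj_eq_iff_im.1 (star_hermitianForm z z)

theorem hermitianForm_self_re (z : Fin 1 ⊕ Fin n → ℂ) :
    (hermitianForm z z).re = ‖z (Sum.inl 0)‖ ^ 2 - ∑ j, ‖z (Sum.inr j)‖ ^ 2 := by
  rw [hermitianForm_eq, Complex.sub_re, Complex.re_sum]
  simp [← Complex.normSq_eq_norm_sq, Complex.normSq_apply]

/-- The Hermitian form is negative definite on the orthogonal complement of a positive vector. -/
theorem eq_zero_of_hermitianForm_eq_zero {z u : Fin 1 ⊕ Fin n → ℂ}
    (hz : (hermitianForm z z).re = 1) (hzu : hermitianForm z u = 0)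
    (hu : 0 ≤ (hermitianForm u u).re) : u = 0 := by
  let Z : EuclideanSpace ℂ (Fin n) := WithLp.toLp 2 fun j => z (Sum.inr j)
  let U : EuclideanSpace ℂ (Fin n) := WithLp.toLp 2 fun j => u (Sum.inr j)
  have hZ : ‖Z‖ ^ 2 = ∑ j, ‖z (Sum.inr j)‖ ^ 2 := EuclideanSpace.norm_sq_eq Z
  have hU : ‖U‖ ^ 2 = ∑ j, ‖u (Sum.inr j)‖ ^ 2 := EuclideanSpace.norm_sq_eq U
  -- Orthogonality to `z` expresses the inner product of the negative parts through the first
  -- coordinates, so that Cauchy–Schwarz bounds the latter.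
  have hin : inner ℂ Z U = star (z (Sum.inl 0)) * u (Sum.inl 0) := by
    rw [hermitianForm_eq, sub_eq_zero] at hzu
    rw [hzu, PiLp.inner_apply]
    exact Finset.sum_congr rfl fun j _ => mul_comm _ _
  have hcs := norm_inner_le_norm (𝕜 := ℂ) Z U
  rw [hin, norm_mul, norm_star] at hcs
  rw [hermitianForm_self_re, ← hZ] at hz
  rw [hermitianForm_self_re, ← hU] at hu
  have hsq : (‖z (Sum.inl 0)‖ * ‖u (Sum.inl 0)‖) ^ 2 ≤ (‖Z‖ * ‖U‖) ^ 2 :=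
    pow_le_pow_left₀ (by positivity) hcs 2
  -- Cauchy–Schwarz with `‖z₀‖² = 1 + ‖Z‖²`; by `hu` both summands are nonnegative, so `u₀`
  -- vanishes, and then so does `U`.
  have h1 : ‖u (Sum.inl 0)‖ ^ 2 + ‖Z‖ ^ 2 * (‖u (Sum.inl 0)‖ ^ 2 - ‖U‖ ^ 2) ≤ 0 := by
    rw [mul_pow, mul_pow] at hsq
    have h2 : ‖z (Sum.inl 0)‖ ^ 2 = 1 + ‖Z‖ ^ 2 := by linarith
    rw [h2] at hsq
    linarith
  have h2 := mul_nonneg (sq_nonneg ‖Z‖) hu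
  have h3 : ‖u (Sum.inl 0)‖ ^ 2 = 0 := le_antisymm (by linarith) (sq_nonneg _)
  have h4 : ‖U‖ ^ 2 = 0 := le_antisymm (by linarith) (sq_nonneg _)
  have h5 : U = 0 := norm_eq_zero.1 (pow_eq_zero_iff two_ne_zero |>.1 h4)
  ext k
  rcases k with k | k
  · obtain rfl := Subsingleton.elim k 0
    exact norm_eq_zero.1 (pow_eq_zero_iff two_ne_zero |>.1 h3)
  · exact congrFun (congrArg WithLp.ofLp h5) k

/-- The matrix of the multiplication by `i` on `ℝ^(2+2n) = ℂ^(1+n)`. -/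
noncomputable def complexStructure (n : ℕ) : Matrix (IndexSO n) (IndexSO n) ℝ :=
  realify (Complex.I • (1 : Matrix (Fin 1 ⊕ Fin n) (Fin 1 ⊕ Fin n) ℂ))

theorem complexify_complexStructure_mulVec (v : AmbientSpace n) :
    complexify (complexStructure n *ᵥ v) = Complex.I • complexify v := by
  rw [complexStructure, complexify_realify_mulVec, smul_mulVec, one_mulVec]

/-- Together with `form_eq_re_hermitianForm` this recovers the Hermitian form from the real form and
the multiplication by `i`. -/
theorem form_complexStructure_mulVec (v w : AmbientSpace n) :
    v ⬝ᵥ formMatrix n *ᵥ (complexStructure n *ᵥ w)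
      = -(hermitianForm (complexify v) (complexify w)).im := by
  rw [form_eq_re_hermitianForm, complexify_complexStructure_mulVec, hermitianForm_smul_right]
  simp

/-- The form of signature `(2, 2n)` as a continuous bilinear map. -/
noncomputable def formCLM (n : ℕ) : AmbientSpace n →L[ℝ] AmbientSpace n →L[ℝ] ℝ :=
  (Matrix.toLinearMap₂' ℝ (formMatrix n)).toContinuousBilinearMap

@[simp]
theorem formCLM_apply (v w : AmbientSpace n) : formCLM n v w = v ⬝ᵥ formMatrix n *ᵥ w := by
  rw [formCLM, LinearMap.toContinuousBilinearMap_apply, Matrix.toLinearMap₂'_apply']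

/-- The multiplication by `i` as a continuous linear map. -/
noncomputable def complexStructureCLM (n : ℕ) : AmbientSpace n →L[ℝ] AmbientSpace n :=
  LinearMap.toContinuousLinearMap (complexStructure n).mulVecLin

/-- The bilinear form `-Re (w, w') + 2 Re (conj (v, w) (v, w'))` on `ℝ^(2+2n) = ℂ^(1+n)`. -/
noncomputable def invariantForm (v : AmbientSpace n) :
    AmbientSpace n →L[ℝ] AmbientSpace n →L[ℝ] ℝ :=
  -formCLM n + (2 : ℝ) • ((formCLM n v).smulRight (formCLM n v)
    + ((formCLM n v).comp (complexStructureCLM n)).smulRight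
      ((formCLM n v).comp (complexStructureCLM n)))

theorem invariantForm_apply (v w w' : AmbientSpace n) :
    invariantForm v w w' = -(w ⬝ᵥ formMatrix n *ᵥ w')
      + 2 * ((v ⬝ᵥ formMatrix n *ᵥ w) * (v ⬝ᵥ formMatrix n *ᵥ w')
        + (v ⬝ᵥ formMatrix n *ᵥ (complexStructure n *ᵥ w))
          * (v ⬝ᵥ formMatrix n *ᵥ (complexStructure n *ᵥ w'))) := by
  simp [invariantForm, complexStructureCLM]
  ring

theorem invariantForm_comm (v w w' : AmbientSpace n) :
    invariantForm v w w' = invariantForm v w' w := by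
  rw [invariantForm_apply, invariantForm_apply, form_comm w w']
  ring

theorem contDiff_invariantForm {k : WithTop ℕ∞} : ContDiff ℝ k (invariantForm (n := n)) := by
  have h1 : ContDiff ℝ k fun v => formCLM n v := (formCLM n).contDiff
  have h2 : ContDiff ℝ k fun v => (formCLM n v).comp (complexStructureCLM n) :=
    h1.clm_comp contDiff_const
  exact contDiff_const.add (((h1.smulRight h1).add (h2.smulRight h2)).const_smul (2 : ℝ))

/-- With `c = h(v, w)`, the vector `w - c v` is orthogonal to `v` and the value equals `-h(w - c v,
w - c v) + |c|²`. Both terms are nonnegative, and they vanish together only for `w = 0`. No tangency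
of `w` is needed, which later allows bounds on whole matrices. -/
theorem invariantForm_pos {v : AmbientSpace n} (hv : v ∈ quadric n) {w : AmbientSpace n}
    (hw : w ≠ 0) : 0 < invariantForm v w w := by
  by_contra hcon
  rw [invariantForm_apply, form_complexStructure_mulVec, form_eq_re_hermitianForm,
    form_eq_re_hermitianForm] at hcon
  have hv' : (hermitianForm (complexify v) (complexify v)).re = 1 := by
    rw [← form_eq_re_hermitianForm]
    exact hv
  have hv1 : hermitianForm (complexify v) (complexify v) = 1 :=
    Complex.ext hv' (hermitianForm_self_im _)
  set z := complexify v
  set x := complexify w with hx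
  set c := hermitianForm z x with hc
  have h1 : hermitianForm z (x - c • z) = 0 := by
    rw [hermitianForm_sub_right, hermitianForm_smul_right, hv1, mul_one, ← hc, sub_self]
  have h2 : hermitianForm (x - c • z) (x - c • z) = hermitianForm x x - c * star c := by
    rw [hermitianForm_sub_left, hermitianForm_smul_left, h1, mul_zero, sub_zero,
      hermitianForm_sub_right, hermitianForm_smul_right, ← star_hermitianForm z x]
  have h3 : (hermitianForm (x - c • z) (x - c • z)).re
      = (hermitianForm x x).re - (c.re * c.re + c.im * c.im) := by
    rw [h2]
    simp
  have h4 : 0 ≤ (hermitianForm (x - c • z) (x - c • z)).re := by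
    rw [h3]
    linarith [mul_self_nonneg c.re, mul_self_nonneg c.im]
  have h5 := eq_zero_of_hermitianForm_eq_zero hv' h1 h4
  have h6 : c = 0 := by
    rw [h5] at h3
    have h7 : hermitianForm (0 : Fin 1 ⊕ Fin n → ℂ) 0 = 0 := by simp [hermitianForm_eq]
    rw [h7, Complex.zero_re] at h3
    have h8 := mul_self_nonneg c.re
    have h9 := mul_self_nonneg c.im
    exact Complex.ext (mul_self_eq_zero.1 (by linarith)) (mul_self_eq_zero.1 (by linarith))
  rw [h6, zero_smul, sub_zero] at h5
  apply hw
  apply complexify_injective n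
  rw [← hx, h5]
  ext k
  rcases k with k | k <;> rfl

/-! ### The action of `U(1, n)` -/

theorem orbitMap_unitary_smul (l : GroupU n) (x : HomogSpace n) :
    orbitMap n (l • x) = realify l.1.1 *ᵥ orbitMap n x :=
  orbitMap_smul (indefiniteUEmbedding (Fin 1) (Fin n) l) x

theorem form_realify_mulVec (l : GroupU n) (v w : AmbientSpace n) :
    (realify l.1.1 *ᵥ v) ⬝ᵥ formMatrix n *ᵥ (realify l.1.1 *ᵥ w) = v ⬝ᵥ formMatrix n *ᵥ w :=
  GroupSO.form_mulVec (indefiniteUEmbedding (Fin 1) (Fin n) l) v w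

theorem complexStructure_mulVec_realify (A : Matrix (Fin 1 ⊕ Fin n) (Fin 1 ⊕ Fin n) ℂ)
    (v : AmbientSpace n) :
    complexStructure n *ᵥ (realify A *ᵥ v) = realify A *ᵥ (complexStructure n *ᵥ v) := by
  rw [mulVec_mulVec, mulVec_mulVec, complexStructure, ← realify_mul, ← realify_mul]
  simp

/-- The form is built from the real form and multiplication by `i`; `U(1, n)` preserves the former
and commutes with the latter. -/
theorem invariantForm_realify_mulVec (l : GroupU n) (v w w' : AmbientSpace n) :
    invariantForm (realify l.1.1 *ᵥ v) (realify l.1.1 *ᵥ w) (realify l.1.1 *ᵥ w')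
      = invariantForm v w w' := by
  simp only [invariantForm_apply, complexStructure_mulVec_realify, form_realify_mulVec]

/-- A complex matrix preserving the Hermitian form, as an element of `U(1, n)`. -/
noncomputable def unitaryOfMatrix (A : Matrix (Fin 1 ⊕ Fin n) (Fin 1 ⊕ Fin n) ℂ)
    (hA : Aᴴ * hermitianMatrix n * A = hermitianMatrix n) : GroupU n :=
  have h : hermitianMatrix n * Aᴴ * hermitianMatrix n * A = 1 := by
    have h1 : hermitianMatrix n * hermitianMatrix n = 1 := by
      rw [hermitianMatrix, indefiniteDiagonal, diagonal_mul_diagonal, ← diagonal_one]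
      congr 1
      ext i
      rcases i with i | i <;> simp
    rw [Matrix.mul_assoc, Matrix.mul_assoc, ← Matrix.mul_assoc Aᴴ, hA, h1]
  ⟨⟨A, hermitianMatrix n * Aᴴ * hermitianMatrix n, mul_eq_one_comm.1 h, h⟩, hA⟩

/-- The matrix is minus the reflection in `w`. In the expansion the two cross terms have coefficient
`-c` each, and the quadratic one `c² h(w, w) = 2c`. -/
theorem hermitian_reflection {J : Matrix (Fin 1 ⊕ Fin n) (Fin 1 ⊕ Fin n) ℂ} (hJ : Jᴴ = J)
    {w : Fin 1 ⊕ Fin n → ℂ} {c : ℂ} (hc : star c = c) (hw : c * (star w ⬝ᵥ J *ᵥ w) = 2) :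
    (-1 + c • vecMulVec w (star (J *ᵥ w)))ᴴ * J * (-1 + c • vecMulVec w (star (J *ᵥ w))) = J := by
  have h1 : vecMulVec (J *ᵥ w) (star w) * J = vecMulVec (J *ᵥ w) (star (J *ᵥ w)) := by
    rw [vecMulVec_mul, star_mulVec, hJ]
  have h2 : J * vecMulVec w (star (J *ᵥ w)) = vecMulVec (J *ᵥ w) (star (J *ᵥ w)) :=
    mul_vecMulVec _ _ _
  have h3 : vecMulVec (J *ᵥ w) (star (J *ᵥ w)) * vecMulVec w (star (J *ᵥ w))
      = (star w ⬝ᵥ J *ᵥ w) • vecMulVec (J *ᵥ w) (star (J *ᵥ w)) := by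
    rw [vecMulVec_mul_vecMulVec, vecMulVec_smul, star_mulVec, hJ, dotProduct_mulVec]
  rw [conjTranspose_add, conjTranspose_neg, conjTranspose_one, conjTranspose_smul,
    conjTranspose_vecMulVec, star_star, hc, add_mul, smul_mul_assoc, h1, neg_mul, one_mul, mul_add,
    add_mul, add_mul, neg_mul, mul_smul_comm, neg_mul, h2, smul_mul_assoc, smul_mul_assoc,
    mul_smul_comm, h3,
    smul_smul c (star w ⬝ᵥ J *ᵥ w), hw, smul_smul]
  simp only [mul_neg, mul_one, neg_neg, smul_neg]
  rw [mul_two, add_smul]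
  abel

/-- `U(1, n)` acts transitively on the quadric. -/
theorem exists_unitary_mulVec {v : AmbientSpace n} (hv : v ∈ quadric n) :
    ∃ l : GroupU n, realify l.1.1 *ᵥ baseVector n = v := by
  set z := complexify v with hz
  have hre : (hermitianForm z z).re = 1 := by
    rw [hz, ← form_eq_re_hermitianForm]
    exact hv
  have hzz : hermitianForm z z = 1 := Complex.ext hre (hermitianForm_self_im z)
  set r : ℝ := ‖z (Sum.inl 0)‖ with hr
  have hr1 : r ≠ 0 := by
    intro h0
    rw [hermitianForm_self_re, ← hr, h0] at hre
    have := Finset.sum_nonneg fun (j : Fin n) (_ : j ∈ Finset.univ) =>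
      sq_nonneg ‖z (Sum.inr j)‖
    norm_num at hre
    linarith
  have hr0 : 0 < r := lt_of_le_of_ne (norm_nonneg _) hr1.symm
  have hrC : (r : ℂ) ≠ 0 := Complex.ofReal_ne_zero.2 hr1
  -- `μ` is the phase of `z₀`; after removing it, `star μ • z` has the positive first coordinate
  -- `r`.
  set μ : ℂ := z (Sum.inl 0) / r with hμ
  have hnorm : z (Sum.inl 0) * star (z (Sum.inl 0)) = (r : ℂ) ^ 2 := Complex.mul_conj' _
  have hsr : star (r : ℂ) = r := Complex.conj_ofReal r
  have hμμ : star μ * μ = 1 := by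
    rw [hμ, star_div₀, hsr, div_mul_div_comm, mul_comm (star _), hnorm, ← pow_two]
    exact div_self (pow_ne_zero 2 hrC)
  set e : Fin 1 ⊕ Fin n → ℂ := Pi.single (Sum.inl 0) 1 with he
  set w : Fin 1 ⊕ Fin n → ℂ := e + star μ • z with hw
  have hμz : star μ * z (Sum.inl 0) = r := by
    rw [hμ, star_div₀, hsr, div_mul_eq_mul_div, mul_comm, hnorm, pow_two, mul_div_assoc,
      div_self hrC, mul_one]
  have hJ : (hermitianMatrix n)ᴴ = hermitianMatrix n := by
    rw [hermitianMatrix, indefiniteDiagonal, diagonal_conjTranspose]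
    congr 1
    ext i
    rcases i with i | i <;> simp
  have hJe : hermitianMatrix n *ᵥ e = e := by
    ext i
    rw [hermitianMatrix, indefiniteDiagonal, mulVec_diagonal]
    rcases i with i | i <;> simp [he]
  have hwe : star w ⬝ᵥ hermitianMatrix n *ᵥ e = 1 + r := by
    rw [hJe, he, dotProduct_single_one, hw]
    have : star (star μ * z (Sum.inl 0)) = (r : ℂ) := by rw [hμz, hsr]
    rw [Pi.star_apply, Pi.add_apply, Pi.smul_apply, smul_eq_mul, star_add, this]
    simp [he]
  have hww : star w ⬝ᵥ hermitianMatrix n *ᵥ w = 2 * (1 + r) := by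
    have h1 : hermitianForm w z = star (hermitianForm z w) := (star_hermitianForm z w).symm
    have h2 : hermitianForm z w = star (z (Sum.inl 0)) + star μ := by
      have : w = e - (-star μ) • z := by rw [hw, neg_smul, sub_neg_eq_add]
      rw [this, hermitianForm_sub_right, hermitianForm_smul_right, hzz, hermitianForm, hJe, he,
        dotProduct_single_one]
      simp
    have h3 : star μ * hermitianForm w z = r + 1 := by
      rw [h1, h2, star_add, star_star, star_star, mul_add, hμz, hμμ]
    have h4 : hermitianForm w w = hermitianForm w e + star μ * hermitianForm w z := by
      have : w = e - (-star μ) • z := by rw [hw, neg_smul, sub_neg_eq_add]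
      nth_rewrite 2 [this]
      rw [hermitianForm_sub_right, hermitianForm_smul_right]
      ring
    change hermitianForm w w = _
    rw [h4, h3]
    change star w ⬝ᵥ hermitianMatrix n *ᵥ e + _ = _
    rw [hwe]
    ring
  have hr2 : (1 + r : ℂ) ≠ 0 := by
    have : (1 + r : ℝ) ≠ 0 := by positivity
    exact_mod_cast this
  -- Since `h(w, w) = 2 (1 + r)`, this is the reflection coefficient. As `h(w, e) = 1 + r`, minus
  -- the reflection sends `e` to `w - e = star μ • z`, and the factor `μ` restores `z`.
  set c : ℂ := 1 / (1 + r) with hc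
  have hcs : star c = c := by
    rw [hc, star_div₀, star_add, star_one, hsr]
  have hrefl := hermitian_reflection (w := w) hJ hcs (by rw [hww, hc]; field_simp)
  refine ⟨unitaryOfMatrix (μ • (-1 + c • vecMulVec w (star (hermitianMatrix n *ᵥ w)))) ?_, ?_⟩
  · rw [conjTranspose_smul, smul_mul_assoc, smul_mul_assoc, mul_smul_comm, hrefl, smul_smul, hμμ,
      one_smul]
  · apply complexify_injective n
    rw [complexify_realify_mulVec, complexify_baseVector, ← he, ← hz]
    change (μ • (-1 + c • vecMulVec w (star (hermitianMatrix n *ᵥ w)))) *ᵥ e = z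
    have h1 : star (hermitianMatrix n *ᵥ w) ⬝ᵥ e = 1 + r := by
      rw [star_mulVec, hJ, ← dotProduct_mulVec, hwe]
    rw [smul_mulVec, add_mulVec, neg_mulVec, one_mulVec, smul_mulVec, vecMulVec_mulVec, h1]
    have h2 : c • MulOpposite.op (1 + r : ℂ) • w = w := by
      ext k
      simp only [Pi.smul_apply, MulOpposite.smul_eq_mul_unop, MulOpposite.unop_op, smul_eq_mul, hc]
      field_simp
    rw [h2, hw, neg_add_cancel_left, smul_smul, mul_comm, hμμ, one_smul]

theorem exists_unitary_smul_eq (x y : HomogSpace n) : ∃ l : GroupU n, l • x = y := by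
  have key : ∀ y : HomogSpace n, ∃ l : GroupU n, l • (QuotientGroup.mk 1 : HomogSpace n) = y := by
    intro y
    obtain ⟨l, hl⟩ := exists_unitary_mulVec (orbitMap_mem_quadric y)
    refine ⟨l, orbitMap_injective n ?_⟩
    rw [orbitMap_unitary_smul, orbitMap_mk]
    change _ *ᵥ ((1 : Matrix (IndexSO n) (IndexSO n) ℝ) *ᵥ _) = _
    rw [one_mulVec, hl]
  obtain ⟨a, ha⟩ := key x
  obtain ⟨b, hb⟩ := key y
  exact ⟨b * a⁻¹, by rw [← ha, mul_smul, inv_smul_smul, hb]⟩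

/-! ### Bornological properness of the action -/

/-- The minimum over the product of `K` with the unit sphere is positive; homogeneity does the rest.
-/
theorem exists_pos_le_invariantForm {K : Set (AmbientSpace n)} (hK : IsCompact K)
    (hKQ : K ⊆ quadric n) :
    ∃ c > 0, ∀ v ∈ K, ∀ w, c * ‖w‖ ^ 2 ≤ invariantForm v w w := by
  have hcont : Continuous fun p : AmbientSpace n × AmbientSpace n =>
      invariantForm p.1 p.2 p.2 :=
    (((contDiff_invariantForm (k := 0)).continuous.comp continuous_fst).clm_apply
      continuous_snd).clm_apply continuous_snd
  have hcomp : IsCompact (K ×ˢ Metric.sphere (0 : AmbientSpace n) 1) :=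
    hK.prod (isCompact_sphere 0 1)
  have hunit : ∃ c > 0, ∀ v ∈ K, ∀ w ∈ Metric.sphere (0 : AmbientSpace n) 1,
      c ≤ invariantForm v w w := by
    rcases (K ×ˢ Metric.sphere (0 : AmbientSpace n) 1).eq_empty_or_nonempty with h | h
    · exact ⟨1, one_pos, fun v hv w hw => absurd (h ▸ mk_mem_prod hv hw) (notMem_empty _)⟩
    · obtain ⟨p, hp, hmin⟩ := hcomp.exists_isMinOn h hcont.continuousOn
      refine ⟨invariantForm p.1 p.2 p.2, invariantForm_pos (hKQ hp.1) ?_, fun v hv w hw =>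
        isMinOn_iff.1 hmin (v, w) ⟨hv, hw⟩⟩
      intro h0
      have := mem_sphere_zero_iff_norm.1 hp.2
      rw [h0, norm_zero] at this
      exact zero_ne_one this
  obtain ⟨c, hc, hle⟩ := hunit
  refine ⟨c, hc, fun v hv w => ?_⟩
  rcases eq_or_ne w 0 with rfl | hw
  · simp
  have hw' : ‖w‖ ≠ 0 := norm_ne_zero_iff.2 hw
  have h1 := hle v hv (‖w‖⁻¹ • w) (mem_sphere_zero_iff_norm.2 (by
    rw [norm_smul, norm_inv, norm_norm, inv_mul_cancel₀ hw']))
  rw [map_smul, map_smul, _root_.smul_apply, smul_eq_mul, smul_eq_mul] at h1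
  calc c * ‖w‖ ^ 2 ≤ ‖w‖⁻¹ * (‖w‖⁻¹ * invariantForm v w w) * ‖w‖ ^ 2 := by gcongr
    _ = invariantForm v w w := by field_simp

/-- By invariance the form at `l v`, evaluated on `l w`, equals the form at `v` on `w`. It is
bounded above over `K` and the unit ball, and bounded below over `K'` by a multiple of `‖l w‖²`. -/
theorem exists_norm_realify_mulVec_le {K K' : Set (AmbientSpace n)} (hK : IsCompact K)
    (hK' : IsCompact K') (hKQ : K' ⊆ quadric n) :
    ∃ M : ℝ, ∀ l : GroupU n, ∀ v ∈ K, realify l.1.1 *ᵥ v ∈ K' →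
      ∀ w : AmbientSpace n, ‖w‖ ≤ 1 → ‖realify l.1.1 *ᵥ w‖ ≤ M := by
  have hcont : Continuous fun p : AmbientSpace n × AmbientSpace n =>
      invariantForm p.1 p.2 p.2 :=
    (((contDiff_invariantForm (k := 0)).continuous.comp continuous_fst).clm_apply
      continuous_snd).clm_apply continuous_snd
  obtain ⟨C, hC⟩ :=
    (hK.prod (isCompact_closedBall (0 : AmbientSpace n) 1)).exists_bound_of_continuousOn
      hcont.continuousOn
  obtain ⟨c, hc, hle⟩ := exists_pos_le_invariantForm hK' hKQ
  refine ⟨Real.sqrt (C / c), fun l v hv hlv w hw => Real.le_sqrt_of_sq_le ?_⟩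
  rw [le_div_iff₀ hc, mul_comm]
  calc _ ≤ _ := hle _ hlv _
    _ = invariantForm v w w := invariantForm_realify_mulVec l v w w
    _ ≤ C := (le_abs_self _).trans (hC (v, w) ⟨hv, mem_closedBall_zero_iff.2 hw⟩)

theorem norm_entry_le_of_realify {A : Matrix (Fin 1 ⊕ Fin n) (Fin 1 ⊕ Fin n) ℂ} {M : ℝ}
    (hA : ∀ w : AmbientSpace n, ‖w‖ ≤ 1 → ‖realify A *ᵥ w‖ ≤ M) (i j : Fin 1 ⊕ Fin n) :
    ‖A i j‖ ≤ M + M := by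
  have h1 : ∀ a b, |realify A a b| ≤ M := by
    intro a b
    have h2 := hA (Pi.single b 1) (by rw [Pi.norm_single, norm_one])
    rw [mulVec_single_one] at h2
    exact (norm_le_pi_norm _ a).trans h2
  refine (Complex.norm_le_abs_re_add_abs_im _).trans (add_le_add ?_ ?_)
  · exact (by
      rw [realify, submatrix_apply, Equiv.symm_apply_apply, Equiv.symm_apply_apply]
      rfl : realify A (Equiv.sumSumSumComm _ _ _ _ (Sum.inl i))
      (Equiv.sumSumSumComm _ _ _ _ (Sum.inl j)) = (A i j).re) ▸ h1 _ _
  · exact (by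
      rw [realify, submatrix_apply, Equiv.symm_apply_apply, Equiv.symm_apply_apply]
      rfl : realify A (Equiv.sumSumSumComm _ _ _ _ (Sum.inr i))
      (Equiv.sumSumSumComm _ _ _ _ (Sum.inl j)) = (A i j).im) ▸ h1 _ _

/-- The matrices in question form a closed bounded set. On it the inverse `J Aᴴ J` is continuous in
`A`, so passing to the topology of the unit group preserves compactness. -/
theorem isCompact_setOf_norm_entry_le (M : ℝ) :
    IsCompact {l : GroupU n | ∀ i j, ‖l.1.1 i j‖ ≤ M} := by
  let K : Set (Matrix (Fin 1 ⊕ Fin n) (Fin 1 ⊕ Fin n) ℂ) :=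
    {A | (∀ i j, A i j ∈ Metric.closedBall (0 : ℂ) M) ∧
      Aᴴ * hermitianMatrix n * A = hermitianMatrix n}
  have hK : IsCompact K := by
    refine IsCompact.inter_right (IsCompact.matrix (isCompact_closedBall 0 M)) ?_
    exact isClosed_eq ((continuous_id.matrix_conjTranspose.mul continuous_const).mul continuous_id)
      continuous_const
  let s : K → GroupU n := fun A => unitaryOfMatrix A.1 A.2.2
  have hs : Continuous s := by
    refine Continuous.subtype_mk (Units.continuous_iff.2 ⟨continuous_subtype_val, ?_⟩) _
    exact ((continuous_const.mul continuous_subtype_val.matrix_conjTranspose).mul continuous_const)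
  have : CompactSpace K := isCompact_iff_compactSpace.1 hK
  convert isCompact_range hs
  ext l
  constructor
  · intro hl
    refine ⟨⟨l.1.1, fun i j => mem_closedBall_zero_iff.2 (hl i j), l.2⟩, ?_⟩
    exact Subtype.ext (Units.ext rfl)
  · rintro ⟨A, rfl⟩ i j
    exact mem_closedBall_zero_iff.1 (A.2.1 i j)

theorem isBornologicallyProper_homogSpace (n : ℕ) :
    IsBornologicallyProper (compactBornology (GroupU n)) (compactBornology (HomogSpace n)) := by
  intro B hB B' hB'
  have hB1 : IsCompact (closure B) := hB
  have hB1' : IsCompact (closure B') := hB'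
  obtain ⟨M, hM⟩ := exists_norm_realify_mulVec_le (hB1.image (continuous_orbitMap n))
    (hB1'.image (continuous_orbitMap n)) (image_subset_iff.2 fun x _ => orbitMap_mem_quadric x)
  have hcompact := isCompact_setOf_norm_entry_le (n := n) (M + M)
  have hsub : {l : GroupU n | (((fun x => l • x) '' B) ∩ B').Nonempty}
      ⊆ {l : GroupU n | ∀ i j, ‖l.1.1 i j‖ ≤ M + M} := by
    rintro l ⟨_, ⟨x, hx, rfl⟩, hlx⟩
    refine norm_entry_le_of_realify (hM l (orbitMap n x)
      (mem_image_of_mem _ (subset_closure hx)) ?_)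
    rw [← orbitMap_unitary_smul]
    exact mem_image_of_mem _ (subset_closure hlx)
  exact hcompact.of_isClosed_subset isClosed_closure (closure_minimal hsub hcompact.isClosed)

/-! ### Connectedness -/

/-- A map onto the quadric, given by polar coordinates in the first two coordinates. -/
noncomputable def polarPoint (p : ℝ × AmbientSpace n) : AmbientSpace n :=
  Sum.elim
    (Sum.elim (fun _ => Real.sqrt (1 + ∑ j, p.2 (Sum.inr j) ^ 2) * Real.cos p.1)
      fun _ => Real.sqrt (1 + ∑ j, p.2 (Sum.inr j) ^ 2) * Real.sin p.1)
    fun j => p.2 (Sum.inr j)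

theorem continuous_polarPoint : Continuous (polarPoint (n := n)) := by
  refine continuous_pi fun i => ?_
  rcases i with (i | i) | i <;> simp only [polarPoint, Sum.elim_inl, Sum.elim_inr] <;> fun_prop

theorem mem_quadric_iff {v : AmbientSpace n} :
    v ∈ quadric n ↔
      v (Sum.inl (Sum.inl 0)) ^ 2 + v (Sum.inl (Sum.inr 0)) ^ 2 = 1 + ∑ j, v (Sum.inr j) ^ 2 := by
  have h : v ⬝ᵥ formMatrix n *ᵥ v = v (Sum.inl (Sum.inl 0)) ^ 2 + v (Sum.inl (Sum.inr 0)) ^ 2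
      - ∑ j, v (Sum.inr j) ^ 2 := by
    simp [indefiniteDiagonal, mulVec_diagonal, dotProduct, Fintype.sum_sum_type]
    simp only [pow_two]
    ring
  change _ = (1 : ℝ) ↔ _
  rw [h, sub_eq_iff_eq_add]

theorem range_polarPoint : range (polarPoint (n := n)) = quadric n := by
  ext v
  constructor
  · rintro ⟨p, rfl⟩
    rw [mem_quadric_iff]
    simp only [polarPoint, Sum.elim_inl, Sum.elim_inr]
    rw [mul_pow, mul_pow, ← mul_add, Real.cos_sq_add_sin_sq, mul_one, Real.sq_sqrt (by positivity)]
  · intro hv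
    rw [mem_quadric_iff] at hv
    let z : ℂ := ⟨v (Sum.inl (Sum.inl 0)), v (Sum.inl (Sum.inr 0))⟩
    have hz : ‖z‖ = Real.sqrt (1 + ∑ j, v (Sum.inr j) ^ 2) := by
      rw [Complex.norm_eq_sqrt_sq_add_sq, ← hv]
    refine ⟨(z.arg, v), ?_⟩
    ext i
    rcases i with (i | i) | i
    · obtain rfl := Subsingleton.elim i 0
      simp only [polarPoint, Sum.elim_inl, ← hz]
      exact Complex.norm_mul_cos_arg z
    · obtain rfl := Subsingleton.elim i 0
      simp only [polarPoint, Sum.elim_inl, Sum.elim_inr, ← hz]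
      exact Complex.norm_mul_sin_arg z
    · rfl

/-- The quadric is a continuous image of a vector space. This is what makes the Riemannian distance
finite. -/
instance homogSpace_preconnectedSpace (n : ℕ) : PreconnectedSpace (HomogSpace n) := by
  refine ⟨(isInducing_orbitMap n).isPreconnected_image.1 ?_⟩
  rw [image_univ, range_orbitMap, ← range_polarPoint]
  exact isPreconnected_range continuous_polarPoint

/-! ### Transitive isometric actions on length spaces -/

/-- A locally compact metric space with approximate intermediate points and a transitive isometric
action is proper. -/
theorem properSpace_of_transitive_of_intermediate {L X : Type*} [Group L] [MulAction L X]
    [MetricSpace X] [LocallyCompactSpace X]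
    (hiso : ∀ (l : L) (x y : X), dist (l • x) (l • y) = dist x y)
    (htrans : ∀ x y : X, ∃ l : L, l • x = y)
    (hmid : ∀ (x y : X) (r s : ℝ), 0 ≤ r → 0 ≤ s → dist x y < r + s →
      ∃ z, dist x z ≤ r ∧ dist z y ≤ s) : ProperSpace X := by
  rcases isEmpty_or_nonempty X with hX | ⟨⟨a⟩⟩
  · exact ⟨fun x => (hX.false x).elim⟩
  obtain ⟨K, hK, hKa⟩ := exists_compact_mem_nhds a
  obtain ⟨δ, hδ, hball⟩ := Metric.nhds_basis_closedBall.mem_iff.1 hKa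
  have hcompact : ∀ x : X, IsCompact (Metric.closedBall x δ) := by
    intro x
    obtain ⟨l, rfl⟩ := htrans a x
    have hcont : Continuous fun y : X => l • y := (Isometry.of_dist_eq (hiso l)).continuous
    have himage : Metric.closedBall (l • a) δ = (fun y => l • y) '' Metric.closedBall a δ := by
      ext y
      constructor
      · intro hy
        refine ⟨l⁻¹ • y, ?_, smul_inv_smul l y⟩
        rwa [Metric.mem_closedBall, ← hiso l, smul_inv_smul]
      · rintro ⟨z, hz, rfl⟩
        rwa [Metric.mem_closedBall, hiso]
    rw [himage]
    exact (hK.of_isClosed_subset Metric.isClosed_closedBall hball).image hcont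
  -- A point at distance at most `r + δ / 4` from `a` is within `δ / 2` of the closed `r`-ball,
  -- hence within `δ` of one of finitely many centres of `δ / 2`-balls covering it. Choosing `δ / 4
  -- < δ / 2` gives the strict inequality needed for `hmid`.
  have hstep : ∀ r : ℝ, 0 ≤ r → IsCompact (Metric.closedBall a r) →
      IsCompact (Metric.closedBall a (r + δ / 4)) := by
    intro r hr hcr
    obtain ⟨t, -, ht, hcover⟩ := hcr.elim_finite_subcover_image (b := Metric.closedBall a r)
      (c := fun z => Metric.ball z (δ / 2)) (fun _ _ => Metric.isOpen_ball)
      fun z hz => mem_iUnion₂.2 ⟨z, hz, Metric.mem_ball_self (half_pos hδ)⟩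
    refine (ht.isCompact_biUnion fun z _ => hcompact z).of_isClosed_subset
      Metric.isClosed_closedBall fun y hy => ?_
    obtain ⟨z, hz, hzy⟩ := hmid a y r (δ / 2) hr (half_pos hδ).le (by
      rw [Metric.mem_closedBall, dist_comm] at hy
      linarith)
    obtain ⟨w, hw, hzw⟩ := mem_iUnion₂.1 (hcover (Metric.mem_closedBall'.2 hz))
    refine mem_iUnion₂.2 ⟨w, hw, ?_⟩
    rw [Metric.mem_ball] at hzw
    rw [Metric.mem_closedBall]
    rw [dist_comm] at hzy
    linarith [dist_triangle y z w]
  have hnat : ∀ k : ℕ, IsCompact (Metric.closedBall a (k * (δ / 4))) := by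
    intro k
    induction k with
    | zero => simp
    | succ k ih =>
      have := hstep _ (by positivity) ih
      rwa [Nat.cast_succ, add_mul, one_mul]
  refine ProperSpace.of_isCompact_closedBall_of_le 0 fun x r _ => ?_
  obtain ⟨k, hk⟩ := exists_nat_ge ((r + dist x a) / (δ / 4))
  rw [div_le_iff₀ (by positivity)] at hk
  refine (hnat k).of_isClosed_subset Metric.isClosed_closedBall
    (Metric.closedBall_subset_closedBall' hk)

theorem metricBornology_eq_compactBornology {X : Type*} [MetricSpace X] [ProperSpace X] :
    metricBornology (dist : X → X → ℝ) = compactBornology X := by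
  ext B
  change (∃ C, ∀ x ∈ B, ∀ y ∈ B, dist x y ≤ C) ↔ IsCompact (closure B)
  constructor
  · rintro ⟨C, hC⟩
    exact (Metric.isBounded_iff.2 ⟨C, fun x hx y hy => hC x hx y hy⟩).isCompact_closure
  · intro h
    obtain ⟨C, hC⟩ := Metric.isBounded_iff.1 (h.isBounded.subset subset_closure)
    exact ⟨C, fun x hx y hy => hC hx hy⟩

theorem associatedCoarseStructure_eq_boundedCoarseStructure {L X : Type*} [Group L] [MulAction L X]
    [MetricSpace X] [ProperSpace X] [Nonempty X]
    (hiso : ∀ (l : L) (x y : X), dist (l • x) (l • y) = dist x y)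
    (htrans : ∀ x y : X, ∃ l : L, l • x = y) :
    associatedCoarseStructure L (compactBornology X)
      = boundedCoarseStructure (dist : X → X → ℝ) := by
  ext E
  constructor
  · rintro ⟨B, hB, hE⟩
    rw [← metricBornology_eq_compactBornology] at hB
    obtain ⟨C, hC⟩ := hB
    -- The diagonal needs a nonnegative bound, and `C` may be negative if `B` is empty.
    refine ⟨max C 0, le_max_right _ _, hE.trans ?_⟩
    rintro _ (⟨l, x, hx, y, hy, rfl⟩ | hp)
    · exact ((hiso l x y).trans_le (hC x hx y hy)).trans (le_max_left _ _)
    · rw [mem_diagonal_iff] at hp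
      change dist _ _ ≤ _
      rw [hp, dist_self]
      exact le_max_right _ _
  · rintro ⟨r, hr, hE⟩
    obtain ⟨a⟩ := ‹Nonempty X›
    -- Moving the first entry of a pair to `a` puts the second one in this ball, which is compact by
    -- properness.
    refine ⟨Metric.closedBall a r, ?_, fun p hp => Or.inl ?_⟩
    · change IsCompact (closure _)
      rw [Metric.isClosed_closedBall.closure_eq]
      exact isCompact_closedBall a r
    · have hpr : dist p.1 p.2 ≤ r := hE hp
      obtain ⟨l, hl⟩ := htrans a p.1
      refine ⟨l, a, Metric.mem_closedBall_self hr, l⁻¹ • p.2, ?_, ?_⟩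
      · rwa [Metric.mem_closedBall', ← hiso l, hl, smul_inv_smul]
      · rw [hl, smul_inv_smul]

/-! ### Pullbacks of fields of bilinear forms -/

section Pullback

open Bundle

variable {E H M V : Type*} [NormedAddCommGroup E] [NormedSpace ℝ E] [TopologicalSpace H]
  {I : ModelWithCorners ℝ E H} [TopologicalSpace M] [ChartedSpace H M]
  [NormedAddCommGroup V] [NormedSpace ℝ V]

/-- The derivative of a map to a vector space. -/
noncomputable def tangentMapCLM (I : ModelWithCorners ℝ E H) (f : M → V) (x : M) :
    TangentSpace I x →L[ℝ] V :=
  mfderiv I 𝓘(ℝ, V) f x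

/-- The pullback of a field of bilinear forms on a vector space. -/
noncomputable def pullbackForm (I : ModelWithCorners ℝ E H) (f : M → V)
    (h : V → V →L[ℝ] V →L[ℝ] ℝ) (x : M) : TangentSpace I x →L[ℝ] TangentSpace I x →L[ℝ] ℝ :=
  ((tangentMapCLM I f x).precomp ℝ).comp ((h (f x)).comp (tangentMapCLM I f x))

theorem pullbackForm_apply (f : M → V) (h : V → V →L[ℝ] V →L[ℝ] ℝ) (x : M)
    (u w : TangentSpace I x) :
    pullbackForm I f h x u w = h (f x) (tangentMapCLM I f x u) (tangentMapCLM I f x w) := rfl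

/-- The pullback of a bilinear form by a linear map. -/
noncomputable def bilinearPullback (E V : Type*) [NormedAddCommGroup E] [NormedSpace ℝ E]
    [NormedAddCommGroup V] [NormedSpace ℝ V] (p : (E →L[ℝ] V) × (V →L[ℝ] V →L[ℝ] ℝ)) :
    E →L[ℝ] E →L[ℝ] ℝ :=
  ((ContinuousLinearMap.compL ℝ E V ℝ).flip p.1).comp (p.2.comp p.1)

set_option synthInstance.maxHeartbeats 100000 in
theorem contDiff_bilinearPullback : ContDiff ℝ ∞ (bilinearPullback E V) := by
  have h : ContDiff ℝ ∞ fun p : (E →L[ℝ] V) × (V →L[ℝ] V →L[ℝ] ℝ) =>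
      (ContinuousLinearMap.compL ℝ E V ℝ).flip p.1 :=
    (ContinuousLinearMap.contDiff _).comp contDiff_fst
  exact h.clm_comp (contDiff_snd.clm_comp contDiff_fst)

/-- In the trivialization at `x₀` the field becomes `bilinearPullback` of the derivative of `f` in
coordinates and of `h ∘ f`, both smooth. -/
theorem contMDiff_pullbackForm [IsManifold I ∞ M] {f : M → V}
    (hf : ContMDiff I 𝓘(ℝ, V) ∞ f) {h : V → V →L[ℝ] V →L[ℝ] ℝ} (hh : ContDiff ℝ ∞ h) :
    ContMDiff I (I.prod 𝓘(ℝ, E →L[ℝ] E →L[ℝ] ℝ)) ∞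
      (fun x => TotalSpace.mk' (E →L[ℝ] E →L[ℝ] ℝ)
        (E := fun x : M => TangentSpace I x →L[ℝ] TangentSpace I x →L[ℝ] ℝ) x
        (pullbackForm I f h x)) := by
  intro x₀
  rw [contMDiffAt_hom_bundle]
  refine ⟨contMDiffAt_id, ?_⟩
  let D : M → E →L[ℝ] V := inTangentCoordinates I 𝓘(ℝ, V) id f (mfderiv I 𝓘(ℝ, V) f) x₀
  have hD : ContMDiffAt I 𝓘(ℝ, E →L[ℝ] V) ∞ D x₀ := (hf x₀).mfderiv_const (by simp)
  have hhf : ContMDiffAt I 𝓘(ℝ, V →L[ℝ] V →L[ℝ] ℝ) ∞ (fun x => h (f x)) x₀ :=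
    hh.contMDiff.contMDiffAt.comp x₀ (hf x₀)
  have hG : ContMDiffAt I 𝓘(ℝ, E →L[ℝ] E →L[ℝ] ℝ) ∞
      (fun x => bilinearPullback E V (D x, h (f x))) x₀ :=
    contDiff_bilinearPullback.contMDiff.contMDiffAt.comp x₀ (hD.prodMk_space hhf)
  refine hG.congr_of_eventuallyEq ?_
  filter_upwards [(trivializationAt E (TangentSpace I) x₀).open_baseSet.mem_nhds
    (FiberBundle.mem_baseSet_trivializationAt' x₀)] with x hx
  have hDx : ∀ v, D x v = tangentMapCLM I f x
      ((trivializationAt E (TangentSpace I) x₀).symm x v) := by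
    intro v
    change (trivializationAt V (TangentSpace 𝓘(ℝ, V)) (f x₀)).continuousLinearMapAt ℝ (f x)
      (mfderiv I 𝓘(ℝ, V) f x ((trivializationAt E (TangentSpace I) x₀).symmL ℝ x v)) = _
    rw [TangentBundle.continuousLinearMapAt_model_space]
    change tangentMapCLM I f x _ = _
    rw [Trivialization.symmL_apply _ hx]
  ext v w
  rw [inCoordinates_apply_eq₂ hx hx (by simp)]
  simp only [pullbackForm_apply, Bundle.Trivial.fiberBundle_trivializationAt',
    Bundle.Trivial.linearMapAt_trivialization, LinearMap.id_apply]
  rw [← hDx, ← hDx]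
  rfl
end Pullback

/-! ### The distance function of a Riemannian manifold -/

section RiemannianDistance

open scoped Bundle ENNReal
open MeasureTheory

variable {E H M : Type*} [NormedAddCommGroup E] [NormedSpace ℝ E] [TopologicalSpace H]
  {I : ModelWithCorners ℝ E H}

/-- Composition with `f` preserves the lengths of paths. -/
theorem riemannianEDist_map_le [TopologicalSpace M] [ChartedSpace H M]
    [Bundle.RiemannianBundle (fun x : M => TangentSpace I x)] {f : M → M}
    (hf : ContMDiff I I 1 f)
    (h : ∀ (x : M) (u : TangentSpace I x), ‖mfderiv I I f x u‖ₑ = ‖u‖ₑ) (x y : M) :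
    riemannianEDist I (f x) (f y) ≤ riemannianEDist I x y := by
  refine le_of_forall_gt fun r hr => ?_
  obtain ⟨γ, h0, h1, hγ, hlt, -⟩ := exists_lt_locally_constant_of_riemannianEDist_lt hr zero_lt_one
  have hlen : pathELength I (f ∘ γ) 0 1 = pathELength I γ 0 1 := by
    rw [pathELength_eq_lintegral_mfderiv_Icc, pathELength_eq_lintegral_mfderiv_Icc]
    refine lintegral_congr fun t => ?_
    rw [mfderiv_comp t (hf.mdifferentiable one_ne_zero _) (hγ.mdifferentiable one_ne_zero t)]
    exact h (γ t) _
  refine (riemannianEDist_le_pathELength (γ := f ∘ γ) (hf.comp hγ).contMDiffOn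
    (congrArg f h0) (congrArg f h1) zero_le_one).trans_lt ?_
  rwa [hlen]

/-- If `y` is farther than `r` from `x`, a path of length less than `r + s` meets the sphere of
radius `r` at `x`; from there on less than `s` of its length is left. -/
theorem exists_edist_le_of_edist_lt_add [PseudoEMetricSpace M] [ChartedSpace H M]
    [Bundle.RiemannianBundle (fun x : M => TangentSpace I x)] [IsRiemannianManifold I M]
    {x y : M} {r s : ℝ≥0∞} (h : edist x y < r + s) :
    ∃ z, edist x z ≤ r ∧ edist z y ≤ s := by
  by_cases hxy : edist x y ≤ r
  · exact ⟨y, hxy, by simp⟩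
  rw [IsRiemannianManifold.out (I := I)] at h
  obtain ⟨γ, h0, h1, hγ, hlt, -⟩ := exists_lt_locally_constant_of_riemannianEDist_lt h zero_lt_one
  have hcont : ContinuousOn (fun t => edist x (γ t)) (Icc 0 1) :=
    (continuous_const.edist hγ.continuous).continuousOn
  obtain ⟨t, ht, htr⟩ := intermediate_value_Icc zero_le_one hcont
    (show r ∈ Icc _ _ from ⟨by simp [h0], by rw [h1]; exact (not_le.1 hxy).le⟩)
  refine ⟨γ t, htr.le, ?_⟩
  by_contra! hs
  have h2 : edist x (γ t) ≤ pathELength I γ 0 t := by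
    rw [IsRiemannianManifold.out (I := I)]
    exact riemannianEDist_le_pathELength hγ.contMDiffOn h0 rfl ht.1
  have h3 : edist (γ t) y ≤ pathELength I γ t 1 := by
    rw [IsRiemannianManifold.out (I := I)]
    exact riemannianEDist_le_pathELength hγ.contMDiffOn rfl h1 ht.2
  have h4 := add_le_add h2 h3
  rw [pathELength_add ht.1 ht.2] at h4
  refine absurd (h4.trans_lt hlt) (not_lt.2 ?_)
  rw [← htr]
  gcongr

/-- The points at finite distance from a given one form a clopen set. -/
theorem edist_ne_top_of_preconnectedSpace {X : Type*} [PseudoEMetricSpace X] [PreconnectedSpace X]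
    (x y : X) : edist x y ≠ ⊤ := by
  have hopen : IsOpen {z | edist z x < ⊤} := isOpen_lt (continuous_id.edist continuous_const)
    continuous_const
  have hclosed : IsClosed {z | edist z x < ⊤} := by
    refine isOpen_compl_iff.1 (EMetric.isOpen_iff.2 fun z hz =>
      ⟨⊤, ENNReal.coe_lt_top, fun w hw => ?_⟩)
    intro hwx
    apply hz
    change edist z x < ⊤
    refine (edist_triangle_left z x w).trans_lt (ENNReal.add_lt_top.2 ⟨?_, hwx⟩)
    exact hw
  have huniv := IsClopen.eq_univ ⟨hclosed, hopen⟩ ⟨x, by simp⟩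
  have hy : y ∈ {z | edist z x < ⊤} := huniv ▸ mem_univ y
  rw [edist_comm]
  exact hy.ne

end RiemannianDistance

/-! ### The orbit map in a homogeneous smooth structure -/

section HomogeneousStructure

variable [ChartedSpace (EuclideanSpace ℝ (Fin (2 * n + 1))) (HomogSpace n)]
  [IsManifold (𝓡 (2 * n + 1)) ∞ (HomogSpace n)]

/-- Pulled back to the group, the coordinates of `orbitMap n` are entries of the first column. -/
theorem IsHomogeneousSmoothStructure.contMDiff_orbitMap (hX : IsHomogeneousSmoothStructure n) :
    ContMDiff (𝓡 (2 * n + 1)) 𝓘(ℝ, AmbientSpace n) ∞ (orbitMap n) := by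
  refine contMDiff_pi_space.2 fun i => contMDiffOn_univ.1 ?_
  refine (hX.smooth_iff univ isOpen_univ _).2 fun g _ => ⟨univ, isOpen_univ, mem_univ _,
    fun A => A i (firstIndex n), (contDiff_apply_apply ℝ ℝ i (firstIndex n)).contDiffOn,
    fun h _ _ => ?_⟩
  change (h.1.1 *ᵥ Pi.single (firstIndex n) 1) i = _
  rw [mulVec_single_one]
  rfl

/-- The coordinates of a chart are smooth, so their pullbacks to the group are, and
`SmoothOnGroup.exists_extension` applies. Locally the chart factors through the orbit map. -/
theorem IsHomogeneousSmoothStructure.exists_chart_extension (hX : IsHomogeneousSmoothStructure n)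
    (x : HomogSpace n) :
    ∃ O : Set (AmbientSpace n), IsOpen O ∧ orbitMap n x ∈ O ∧
      ∃ Φ : AmbientSpace n → EuclideanSpace ℝ (Fin (2 * n + 1)), ContDiffOn ℝ ∞ Φ O ∧
        ∀ᶠ y in 𝓝 x, extChartAt (𝓡 (2 * n + 1)) x y = Φ (orbitMap n y) := by
  let c := chartAt (EuclideanSpace ℝ (Fin (2 * n + 1))) x
  have hx : x ∈ c.source := mem_chart_source _ x
  have hc : ∀ i, ContMDiffOn (𝓡 (2 * n + 1)) 𝓘(ℝ, ℝ) ∞ (fun y => c y i) c.source := by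
    intro i
    have h1 : ContMDiffOn (𝓡 (2 * n + 1)) (𝓡 (2 * n + 1)) ∞ c c.source := contMDiffOn_chart
    exact (EuclideanSpace.proj (𝕜 := ℝ) i).contMDiff.comp_contMDiffOn h1
  choose O hO hxO F hF hcF using fun i =>
    SmoothOnGroup.exists_extension ((hX.smooth_iff c.source c.open_source _).1 (hc i)) hx
  refine ⟨⋂ i, O i, isOpen_iInter_of_finite hO, mem_iInter.2 hxO,
    fun v => WithLp.toLp 2 fun i => F i v, ?_, ?_⟩
  · refine contDiffOn_euclidean.2 fun i => (hF i).mono (iInter_subset _ i)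
  · filter_upwards [c.open_source.mem_nhds hx,
      ((isOpen_iInter_of_finite hO).preimage (continuous_orbitMap n)).mem_nhds
        (mem_iInter.2 hxO)] with y hy hyO
    ext i
    exact hcF i y hy (mem_iInter.1 hyO i)

/-- The invertible derivative of the chart factors through that of the orbit map. -/
theorem IsHomogeneousSmoothStructure.tangentMap_orbitMap_injective
    (hX : IsHomogeneousSmoothStructure n) (x : HomogSpace n) :
    Function.Injective (tangentMapCLM (𝓡 (2 * n + 1)) (orbitMap n) x) := by
  obtain ⟨O, hO, hxO, Φ, hΦ, heq⟩ := hX.exists_chart_extension x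
  have hinv : (mfderiv (𝓡 (2 * n + 1)) 𝓘(ℝ, EuclideanSpace ℝ (Fin (2 * n + 1)))
      (extChartAt (𝓡 (2 * n + 1)) x) x).IsInvertible :=
    isInvertible_mfderiv_extChartAt (mem_extChartAt_source x)
  have hΦx : MDifferentiableAt 𝓘(ℝ, AmbientSpace n) 𝓘(ℝ, EuclideanSpace ℝ (Fin (2 * n + 1))) Φ
      (orbitMap n x) :=
    ((hΦ.contDiffAt (hO.mem_nhds hxO)).differentiableAt (by simp)).mdifferentiableAt
  have hcomp : mfderiv (𝓡 (2 * n + 1)) 𝓘(ℝ, EuclideanSpace ℝ (Fin (2 * n + 1)))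
      (extChartAt (𝓡 (2 * n + 1)) x) x
        = (mfderiv 𝓘(ℝ, AmbientSpace n) 𝓘(ℝ, EuclideanSpace ℝ (Fin (2 * n + 1))) Φ
          (orbitMap n x)).comp (mfderiv (𝓡 (2 * n + 1)) 𝓘(ℝ, AmbientSpace n) (orbitMap n) x) := by
    rw [EventuallyEq.mfderiv_eq (f := Φ ∘ orbitMap n) heq]
    exact mfderiv_comp x hΦx (hX.contMDiff_orbitMap.mdifferentiable (by simp) x)
  intro u w huw
  apply hinv.injective
  rw [hcomp]
  exact congrArg (mfderiv 𝓘(ℝ, AmbientSpace n) 𝓘(ℝ, EuclideanSpace ℝ (Fin (2 * n + 1))) Φ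
    (orbitMap n x)) huw

/-- Near `x` the chart at `f x`, composed with `f`, is a smooth function of `orbitMap n ∘ f`. -/
theorem IsHomogeneousSmoothStructure.contMDiff_of_comp_orbitMap
    (hX : IsHomogeneousSmoothStructure n) {f : HomogSpace n → HomogSpace n} (hf : Continuous f)
    (h : ContMDiff (𝓡 (2 * n + 1)) 𝓘(ℝ, AmbientSpace n) ∞ (orbitMap n ∘ f)) :
    ContMDiff (𝓡 (2 * n + 1)) (𝓡 (2 * n + 1)) ∞ f := by
  intro x
  obtain ⟨O, hO, hxO, Φ, hΦ, heq⟩ := hX.exists_chart_extension (f x)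
  refine contMDiffAt_iff_target.2 ⟨hf.continuousAt, ?_⟩
  have h1 : ContMDiffAt (𝓡 (2 * n + 1)) 𝓘(ℝ, EuclideanSpace ℝ (Fin (2 * n + 1))) ∞
      (Φ ∘ (orbitMap n ∘ f)) x :=
    ContMDiffAt.comp x (hΦ.contDiffAt (hO.mem_nhds hxO)).contMDiffAt (h x)
  exact h1.congr_of_eventuallyEq (hf.continuousAt.eventually heq)

theorem continuous_unitary_smul (l : GroupU n) : Continuous fun x : HomogSpace n => l • x :=
  continuous_const_smul (indefiniteUEmbedding (Fin 1) (Fin n) l)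

theorem IsHomogeneousSmoothStructure.contMDiff_smul (hX : IsHomogeneousSmoothStructure n)
    (l : GroupU n) :
    ContMDiff (𝓡 (2 * n + 1)) (𝓡 (2 * n + 1)) ∞ fun x : HomogSpace n => l • x := by
  refine hX.contMDiff_of_comp_orbitMap (continuous_unitary_smul l) ?_
  have h1 : orbitMap n ∘ (fun x : HomogSpace n => l • x)
      = fun x => realify l.1.1 *ᵥ orbitMap n x := funext fun x => orbitMap_unitary_smul l x
  rw [h1]
  exact (contDiff_mulVec (realify l.1.1)).contMDiff.comp hX.contMDiff_orbitMap

/-- The chain rule, applied to both sides of the equivariance of the orbit map. -/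
theorem IsHomogeneousSmoothStructure.tangentMap_smul (hX : IsHomogeneousSmoothStructure n)
    (l : GroupU n) (x : HomogSpace n) (u : TangentSpace (𝓡 (2 * n + 1)) x) :
    tangentMapCLM (𝓡 (2 * n + 1)) (orbitMap n) (l • x)
        (mfderiv (𝓡 (2 * n + 1)) (𝓡 (2 * n + 1)) (fun y : HomogSpace n => l • y) x u)
      = realify l.1.1 *ᵥ tangentMapCLM (𝓡 (2 * n + 1)) (orbitMap n) x u := by
  let A : AmbientSpace n →L[ℝ] AmbientSpace n :=
    LinearMap.toContinuousLinearMap (realify l.1.1).mulVecLin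
  have hι : MDifferentiable (𝓡 (2 * n + 1)) 𝓘(ℝ, AmbientSpace n) (orbitMap n) :=
    hX.contMDiff_orbitMap.mdifferentiable (by simp)
  have h1 : mfderiv (𝓡 (2 * n + 1)) 𝓘(ℝ, AmbientSpace n)
      (orbitMap n ∘ fun y : HomogSpace n => l • y) x = _ :=
    mfderiv_comp x (hι (l • x)) ((hX.contMDiff_smul l).mdifferentiable (by simp) x)
  have h2 : mfderiv (𝓡 (2 * n + 1)) 𝓘(ℝ, AmbientSpace n) (A ∘ orbitMap n) x = _ :=
    mfderiv_comp x A.mdifferentiableAt (hι x)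
  have h3 : (orbitMap n ∘ fun y : HomogSpace n => l • y) = A ∘ orbitMap n :=
    funext fun y => orbitMap_unitary_smul l y
  rw [h3, h2, A.mfderiv_eq] at h1
  exact (congrArg (fun D : EuclideanSpace ℝ (Fin (2 * n + 1)) →L[ℝ] AmbientSpace n => D u) h1).symm

/-- The Riemannian metric on `X` induced by `invariantForm`. -/
noncomputable def IsHomogeneousSmoothStructure.riemannianMetric
    (hX : IsHomogeneousSmoothStructure n) :
    Bundle.ContMDiffRiemannianMetric (𝓡 (2 * n + 1)) ∞ (EuclideanSpace ℝ (Fin (2 * n + 1)))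
      (fun x : HomogSpace n => TangentSpace (𝓡 (2 * n + 1)) x) where
  inner x := pullbackForm (𝓡 (2 * n + 1)) (orbitMap n) invariantForm x
  symm x u w := by
    rw [pullbackForm_apply, pullbackForm_apply, invariantForm_comm]
  pos x u hu := by
    rw [pullbackForm_apply]
    exact invariantForm_pos (orbitMap_mem_quadric x) fun h =>
      hu (hX.tangentMap_orbitMap_injective x (h.trans (map_zero _).symm))
  isVonNBounded x := by
    let D : EuclideanSpace ℝ (Fin (2 * n + 1)) →L[ℝ] AmbientSpace n :=
      tangentMapCLM (𝓡 (2 * n + 1)) (orbitMap n) x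
    change Bornology.IsVonNBounded ℝ {u : EuclideanSpace ℝ (Fin (2 * n + 1)) |
      invariantForm (orbitMap n x) (D u) (D u) < 1}
    obtain ⟨c, hc, hle⟩ := exists_pos_le_invariantForm (isCompact_singleton (x := orbitMap n x))
      (singleton_subset_iff.2 (orbitMap_mem_quadric x))
    -- An injective linear map on a finite-dimensional space is bounded below; with `c ‖D u‖² < 1`
    -- this bounds `‖u‖`.
    obtain ⟨K, -, hK⟩ := D.toLinearMap.exists_antilipschitzWith
      (LinearMap.ker_eq_bot.2 (hX.tangentMap_orbitMap_injective x))
    refine (NormedSpace.isVonNBounded_closedBall ℝ _ (K * Real.sqrt (1 / c))).subset fun u hu => ?_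
    have h1 : ‖u‖ ≤ K * ‖D u‖ := by
      have := hK.le_mul_dist u 0
      rwa [map_zero, dist_zero_right, dist_zero_right] at this
    rw [mem_closedBall_zero_iff]
    refine h1.trans (mul_le_mul_of_nonneg_left (Real.le_sqrt_of_sq_le ?_) K.2)
    rw [le_div_iff₀ hc, mul_comm]
    exact (hle _ rfl _).trans (le_of_lt hu)
  contMDiff := contMDiff_pullbackForm hX.contMDiff_orbitMap contDiff_invariantForm

end HomogeneousStructure

/-! ### The invariant Riemannian distance on `X`. -/

section MainTheorem

open scoped Bundle

theorem IsHomogeneousSmoothStructure.exists_invariant_distance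
    [ChartedSpace (EuclideanSpace ℝ (Fin (2 * n + 1))) (HomogSpace n)]
    [IsManifold (𝓡 (2 * n + 1)) ∞ (HomogSpace n)] (hX : IsHomogeneousSmoothStructure n) :
    ∃ d : HomogSpace n → HomogSpace n → ℝ,
      IsCompatibleMetric d ∧ IsRiemannianDistance hX.riemannianMetric d ∧
      metricBornology d = compactBornology (HomogSpace n) ∧
      associatedCoarseStructure (GroupU n) (compactBornology (HomogSpace n))
        = boundedCoarseStructure d := by
  -- This separation property enters in the construction of the Riemannian distance as a metric
  -- inducing the given topology.
  have hT3 : T3Space (HomogSpace n) := (isEmbedding_orbitMap n).t3Space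
  let : Bundle.RiemannianBundle
    (fun x : HomogSpace n => TangentSpace (𝓡 (2 * n + 1)) x) :=
      ⟨hX.riemannianMetric.toRiemannianMetric⟩
  have : IsContinuousRiemannianBundle (EuclideanSpace ℝ (Fin (2 * n + 1)))
      (fun x : HomogSpace n => TangentSpace (𝓡 (2 * n + 1)) x) :=
    ⟨hX.riemannianMetric.inner, hX.riemannianMetric.contMDiff.continuous, fun _ _ _ => rfl⟩
  let me : EMetricSpace (HomogSpace n) :=
    EMetricSpace.ofRiemannianMetric (𝓡 (2 * n + 1)) (HomogSpace n)
  let m : MetricSpace (HomogSpace n) :=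
    EMetricSpace.toMetricSpace edist_ne_top_of_preconnectedSpace
  have hR : IsRiemannianManifold (𝓡 (2 * n + 1)) (HomogSpace n) := ⟨fun x y => rfl⟩
  have hloc : LocallyCompactSpace (HomogSpace n) :=
    ChartedSpace.locallyCompactSpace (EuclideanSpace ℝ (Fin (2 * n + 1))) (HomogSpace n)
  have hnorm : ∀ (l : GroupU n) (x : HomogSpace n) (u : TangentSpace (𝓡 (2 * n + 1)) x),
      ‖mfderiv (𝓡 (2 * n + 1)) (𝓡 (2 * n + 1)) (fun y : HomogSpace n => l • y) x u‖ₑ = ‖u‖ₑ := by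
    intro l x u
    refine enorm_eq_iff_norm_eq.2 ?_
    rw [norm_eq_sqrt_real_inner, norm_eq_sqrt_real_inner]
    congr 1
    change pullbackForm (𝓡 (2 * n + 1)) (orbitMap n) invariantForm (l • x) _ _
      = pullbackForm (𝓡 (2 * n + 1)) (orbitMap n) invariantForm x u u
    rw [pullbackForm_apply, pullbackForm_apply, hX.tangentMap_smul, orbitMap_unitary_smul,
      invariantForm_realify_mulVec]
  have hiso : ∀ (l : GroupU n) (x y : HomogSpace n), dist (l • x) (l • y) = dist x y := by
    -- It suffices that no element increases distances, since the inequality for `l⁻¹` is the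
    -- reverse one.
    have hle : ∀ (l : GroupU n) (x y : HomogSpace n), edist (l • x) (l • y) ≤ edist x y :=
      fun l x y => riemannianEDist_map_le ((hX.contMDiff_smul l).of_le (by simp)) (hnorm l) x y
    intro l x y
    have h1 : edist (l • x) (l • y) = edist x y := by
      refine le_antisymm (hle l x y) ?_
      have h2 := hle l⁻¹ (l • x) (l • y)
      rwa [inv_smul_smul, inv_smul_smul] at h2
    rw [dist_edist, dist_edist, h1]
  have hproper : ProperSpace (HomogSpace n) := by
    refine properSpace_of_transitive_of_intermediate hiso exists_unitary_smul_eq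
      fun x y r s hr hs hxy => ?_
    obtain ⟨z, hz, hzy⟩ := exists_edist_le_of_edist_lt_add (I := 𝓡 (2 * n + 1)) (x := x) (y := y)
      (r := ENNReal.ofReal r) (s := ENNReal.ofReal s) (by
        rw [← ENNReal.ofReal_add hr hs, edist_dist]
        exact (ENNReal.ofReal_lt_ofReal_iff_of_nonneg dist_nonneg).2 hxy)
    exact ⟨z, (edist_le_ofReal hr).1 hz, (edist_le_ofReal hs).1 hzy⟩
  refine ⟨dist, ⟨m, rfl, rfl⟩, fun x y => ?_, metricBornology_eq_compactBornology,
    associatedCoarseStructure_eq_boundedCoarseStructure hiso exists_unitary_smul_eq⟩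
  rw [← edist_dist]
  rfl

theorem mainTheorem10 (n : ℕ) (hn : 0 < n) :
    IsBornologicallyProper (compactBornology (GroupU n)) (compactBornology (HomogSpace n)) ∧
    (∃ _ : ChartedSpace (EuclideanSpace ℝ (Fin (2 * n + 1))) (HomogSpace n),
      IsHomogeneousSmoothStructure n) ∧
    ∀ [ChartedSpace (EuclideanSpace ℝ (Fin (2 * n + 1))) (HomogSpace n)]
      [IsManifold (𝓡 (2 * n + 1)) ∞ (HomogSpace n)],
      IsHomogeneousSmoothStructure n →
      ∃ (g : Bundle.ContMDiffRiemannianMetric (𝓡 (2 * n + 1)) ∞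
            (EuclideanSpace ℝ (Fin (2 * n + 1)))
            (fun x : HomogSpace n => TangentSpace (𝓡 (2 * n + 1)) x))
        (d : HomogSpace n → HomogSpace n → ℝ),
        IsCompatibleMetric d ∧ IsRiemannianDistance g d ∧
        metricBornology d = compactBornology (HomogSpace n) ∧
        associatedCoarseStructure (GroupU n) (compactBornology (HomogSpace n))
          = boundedCoarseStructure d :=
  ⟨isBornologicallyProper_homogSpace n,
    ⟨homogSpaceChartedSpace n, homogSpace_isHomogeneousSmoothStructure n⟩,
    fun hX => ⟨hX.riemannianMetric, hX.exists_invariant_distance⟩⟩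

end MainTheorem
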